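/- Fix $d\ge 2$ and a continuous activation $\varphi:\mathbb{R}\to\mathbb{R}$ that is not a polynomial function. Definitions. A \emph{neural network} $\mathbb{R}^m\to\mathbb{R}$ is one output unit of a multi-layer perceptron with any number of hidden layers of any widths, hidden activation $\varphi$ applied coordinatewise, and an output unit that is linear, or an affinely rescaled sigmoid $t\mapsto a\,\sigma(t)+c$, or one component of a softmax; here $\sigma(t)=1/(1+e^{-t})$. A \emph{deep sigmoidal flow} is a map $g=(g_1,\dots,g_d):\mathbb{R}^d\to\mathbb{R}^d$ of the form $$g_k(x)=\sigma^{-1}\Big(\sum_{j=1}^{n} w_{k,j}(x_{\le k-1})\,\sigma\Big(\frac{x_k-b_{k,j}(x_{\le k-1})}{\tau_{k,j}(x_{\le k-1})}\Big)\Big),\qquad x_{\le k-1}=(x_1,\dots,x_{k-1}),$$ where $n\ge 1$ and $w_{k,j},b_{k,j},\tau_{k,j}:\mathbb{R}^{k-1}\to\mathbb{R}$ are neural networks such that everywhere $b_{k,j}\in(r_0,r_1)$, $\tau_{k,j}\in(0,r_2)$, $w_{k,j}>0$ and $\sum_{j=1}^n w_{k,j}=1$, for some $r_0,r_1\in\mathbb{R}$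 and $r_2>0$ (which may depend on $g$). $\mathrm{DSF}$ is the set of all deep sigmoidal flows, and $\mathrm{INN}_{\mathrm{DSF}}$ is the set of all maps $W_1\circ g_1\circ\cdots\circ W_N\circ g_N$ with $N\ge1$, $g_i\in\mathrm{DSF}$ and $W_i$ invertible affine transforms of $\mathbb{R}^d$. A map $f:\mathbb{R}^d\to\mathbb{R}^d$ is \emph{locally bounded} if each point of $\mathbb{R}^d$ has a neighborhood on which $f$ is bounded. A set $\mathcal{M}$ of maps $\mathbb{R}^d\to\mathbb{R}^d$ is a \emph{$\sup$-universal approximator} for a class $\mathcal{F}$ of maps $f:U_f\to\mathbb{R}^d$ with $U_f\subset\mathbb{R}^d$ if for all $f\in\mathcal{F}$, $\varepsilon>0$ and compact $K\subset U_f$ there is $g\in\mathcal{M}$ with $\sup_{x\in K}\|f(x)-g(x)\|<\varepsilon$ (Euclidean norm). $\mathcal{S}^1_c$ is the set of all $C^1$-diffeomorphisms $\mathbb{R}^d\to\mathbb{R}^d$ of the form $\tau(x)=(x_1,\dots,x_{d-1},\tau_d(x))$ that equal the identity outside some compact set. $\mathcal{D}^2$ is the set of all $C^2$-diffeomorphisms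 $f:U_f\to \mathrm{Im}(f)\subset\mathbb{R}^d$, where $U_f\subset\mathbb{R}^d$ is an open set $C^2$-diffeomorphic to $\mathbb{R}^d$ (which may depend on $f$). Proposition. Every element of $\mathrm{DSF}$ is locally bounded, $\mathrm{INN}_{\mathrm{DSF}}$ is a $\sup$-universal approximator for $\mathcal{S}^1_c$, and $\mathrm{INN}_{\mathrm{DSF}}$ is a $\sup$-universal approximator for $\mathcal{D}^2$. -/

import Mathlib

open scoped ENNReal

namespace DSFlow

/-- `ℝ^d` with its Euclidean norm. -/
abbrev E (d : ℕ) : Type := EuclideanSpace ℝ (Fin d)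

/-! ### Supremum norm on a set and sup-universality -/

/-- `‖f‖_{sup,K} = sup_{x ∈ K} ‖f x‖`, as an extended nonnegative real (`0` for `K = ∅`,
`∞` if `f` is unbounded on `K`). -/
noncomputable def supNorm {m n : ℕ} (K : Set (E m)) (f : E m → E n) : ℝ≥0∞ :=
  ⨆ x ∈ K, ‖f x‖ₑ

/-- A map `f : U_f → ℝ^n` on a subset `U_f = dom` of `ℝ^m`; the values of `toFun` outside `dom`
are irrelevant. -/
structure PartialMap (m n : ℕ) where
  dom : Set (E m)
  toFun : E m → E n

/-- The model `M` is a `sup`-universal approximator for the class `F` of partially defined maps: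
every `f ∈ F` is approximated by elements of `M`, uniformly and to any precision, on every compact
subset of the domain of `f`. -/
def IsSupUniversal {m n : ℕ} (M : Set (E m → E n)) (F : Set (PartialMap m n)) : Prop :=
  ∀ f ∈ F, ∀ ε : ℝ, 0 < ε → ∀ K : Set (E m), IsCompact K → K ⊆ f.dom →
    ∃ g ∈ M, supNorm K (fun x => f.toFun x - g x) < ENNReal.ofReal ε

/-- Every point has a neighborhood on which `f` is bounded. -/
def IsLocallyBounded {m n : ℕ} (f : E m → E n) : Prop :=
  ∀ x, ∃ U ∈ nhds x, Bornology.IsBounded (f '' U)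

/-! ### Diffeomorphisms and the target classes -/

/-- `f` restricts to a `C^r`-diffeomorphism from the open set `U` onto the open set `V`
(a homeomorphism for `r = 0`). -/
def IsDiffeoOn {d : ℕ} (r : ℕ∞) (f : E d → E d) (U V : Set (E d)) : Prop :=
  IsOpen U ∧ IsOpen V ∧ Set.BijOn f U V ∧ ContDiffOn ℝ r f U ∧
    ∃ g : E d → E d, Set.InvOn g f U V ∧ ContDiffOn ℝ r g V

/-- The class `𝒟²` of all `C²`-diffeomorphisms `f : U_f → Im f ⊆ ℝ^d`, where `U_f ⊆ ℝ^d` is an open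
set that is `C²`-diffeomorphic to `ℝ^d`. -/
def DTwo (d : ℕ) : Set (PartialMap d d) :=
  {f | (∃ ψ : E d → E d, IsDiffeoOn 2 ψ f.dom Set.univ) ∧
    ∃ V : Set (E d), IsDiffeoOn 2 f.toFun f.dom V}

/-- The class `𝒮_c^r` of single-coordinate transformations: `C^r`-diffeomorphisms of `ℝ^d` onto
itself that alter only the last coordinate and equal the identity outside some compact set. -/
def SingleCoord (d : ℕ) (r : ℕ∞) : Set (PartialMap d d) :=
  {f | f.dom = Set.univ ∧ IsDiffeoOn r f.toFun Set.univ Set.univ ∧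
    (∀ (x : E d) (i : Fin d), (i : ℕ) + 1 < d → f.toFun x i = x i) ∧
    ∃ C : Set (E d), IsCompact C ∧ ∀ x, x ∉ C → f.toFun x = x}

/-! ### Invertible neural networks built from a set of layers -/

/-- Invertible affine transforms `x ↦ A x + b` of `ℝ^d`. -/
def Aff (d : ℕ) : Set (E d → E d) :=
  {W | ∃ (A : E d ≃ₗ[ℝ] E d) (b : E d), W = fun x => A x + b}

/-- `IsINN G f`: `f = W₁ ∘ g₁ ∘ ⋯ ∘ Wₙ ∘ gₙ` with `n ≥ 1`, `gᵢ ∈ G` and `Wᵢ` invertible affine. -/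
inductive IsINN {d : ℕ} (G : Set (E d → E d)) : (E d → E d) → Prop
  | single {W g : E d → E d} : W ∈ Aff d → g ∈ G → IsINN G (W ∘ g)
  | cons {W g h : E d → E d} : W ∈ Aff d → g ∈ G → IsINN G h → IsINN G (W ∘ g ∘ h)

/-- The set of invertible neural networks based on `G`. -/
def INN {d : ℕ} (G : Set (E d → E d)) : Set (E d → E d) := {f | IsINN G f}

/-! ### Neural networks -/

/-- `IsMLP φ m p f`: `f : ℝ^m → ℝ^p` is a multi-layer perceptron with any number of hidden layers
(of any widths), activation `φ` acting coordinatewise in the hidden layers, and an affine last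
layer. -/
inductive IsMLP (φ : ℝ → ℝ) (m : ℕ) : (p : ℕ) → ((Fin m → ℝ) → (Fin p → ℝ)) → Prop
  | affine {p : ℕ} (A : Matrix (Fin p) (Fin m) ℝ) (c : Fin p → ℝ) :
      IsMLP φ m p (fun x => A.mulVec x + c)
  | layer {p q : ℕ} {f : (Fin m → ℝ) → (Fin p → ℝ)} (hf : IsMLP φ m p f)
      (A : Matrix (Fin q) (Fin p) ℝ) (c : Fin q → ℝ) :
      IsMLP φ m q (fun x => A.mulVec (fun i => φ (f x i)) + c)

/-- The softmax map. -/
noncomputable def softmax {p : ℕ} (v : Fin p → ℝ) (i : Fin p) : ℝ :=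
  Real.exp (v i) / ∑ l, Real.exp (v l)

/-- A scalar neural network with hidden activation `φ`: one output unit of a multi-layer
perceptron, where the output unit is linear, or an (affinely rescaled) sigmoid, or one component of
a softmax. -/
def IsNeuralNetwork (φ : ℝ → ℝ) (m : ℕ) (h : (Fin m → ℝ) → ℝ) : Prop :=
  ∃ (p : ℕ) (f : (Fin m → ℝ) → (Fin p → ℝ)) (i : Fin p), IsMLP φ m p f ∧
    ((h = fun x => f x i) ∨
      (∃ a c : ℝ, h = fun x => a * Real.sigmoid (f x i) + c) ∨
      (h = fun x => softmax (f x) i))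

/-! ### Deep sigmoidal flows -/

/-- The inverse `(0,1) → ℝ` of the sigmoid function. -/
noncomputable def logit (y : ℝ) : ℝ := Real.log (y / (1 - y))

theorem logit_sigmoid (x : ℝ) : logit (Real.sigmoid x) = x := by
  have h : Real.sigmoid x / (1 - Real.sigmoid x) = Real.exp x := by
    rw [← Real.sigmoid_neg, ← Real.sigmoid_mul_rexp_neg, Real.exp_neg]
    have := (Real.sigmoid_pos x).ne'
    field_simp
  rw [logit, h, Real.log_exp]

/-- The vector of the coordinates of `x` that precede the `k`-th one. -/
def before {d : ℕ} (k : Fin d) (x : E d) : Fin (k : ℕ) → ℝ :=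
  fun i => x ⟨i, i.isLt.trans k.isLt⟩

/-- The set of all deep sigmoidal flows on `ℝ^d` whose parameters are neural networks with hidden
activation `φ`. -/
def DSF (φ : ℝ → ℝ) (d : ℕ) : Set (E d → E d) :=
  {g | ∃ (n : ℕ) (w b τ : (k : Fin d) → Fin n → (Fin (k : ℕ) → ℝ) → ℝ) (r₀ r₁ r₂ : ℝ),
    0 < r₂ ∧
    (∀ (k : Fin d) (j : Fin n), IsNeuralNetwork φ k (w k j) ∧ IsNeuralNetwork φ k (b k j) ∧
      IsNeuralNetwork φ k (τ k j)) ∧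
    (∀ k j y, b k j y ∈ Set.Ioo r₀ r₁ ∧ τ k j y ∈ Set.Ioo 0 r₂ ∧ 0 < w k j y) ∧
    (∀ k y, ∑ j, w k j y = 1) ∧
    ∀ x k, g x k = logit (∑ j, w k j (before k x) *
      Real.sigmoid ((x k - b k j (before k x)) / τ k j (before k x)))}

end DSFlow

namespace DSFlow

/-! ### Continuity of neural networks and of the flows -/

/-! Networks, and hence flows, are continuous, which gives local boundedness. For the approximation
statements, note that a flow is triangular and increasing in each variable. Conversely, flows
approximate every continuous triangular map whose components are strictly increasing in their own
variable, uniformly on compacts (`exists_mem_DSF_approx`). After applying the sigmoid, such a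
component is nearly a step function in its last variable, that is, a mixture of steep sigmoids on a
grid. The weights of the mixture are continuous in the earlier variables and are approximated by
softmax outputs, because one-hidden-layer networks with a nonpolynomial activation are dense
(`ridgeClosure_eq_top`).

A map in `SingleCoord` is itself triangular and increasing, so one flow suffices. For `DTwo`, the
relation `SteersTo` composes. Coordinate swaps are affine, so any single coordinate can be changed
increasingly. If `B - A` is Lipschitz with a small constant relative to `A`, then `A` is steered to
`B` one coordinate at a time (`SteersTo.of_close`). An embedding `F` is joined to its derivative at
`0` by the isotopy `(F (t x) - F 0) / t`, which splits into finitely many such small moves, in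
either direction. As linear isomorphisms are free, any embedding of a ball can be steered to any
other (`SteersTo.of_embeddings`), whatever the orientations. Given `f` on `U` and a chart inverse `g
: ℝ^d → U`, steering `g` to `f ∘ g` approximates `f` on compacts, and `f` never has to be extended
beyond `U`. -/

theorem IsMLP.continuous {φ : ℝ → ℝ} (hφ : Continuous φ) {m p : ℕ}
    {f : (Fin m → ℝ) → (Fin p → ℝ)} (hf : IsMLP φ m p f) : Continuous f := by
  induction hf with
  | affine A c => fun_prop
  | layer hf A c ih =>
    have : ∀ i, Continuous fun x => φ (_) := fun i => hφ.comp ((continuous_apply i).comp ih)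
    exact ((Matrix.mulVecLin A).continuous_of_finiteDimensional.comp (continuous_pi this)).add
      continuous_const

theorem continuous_softmax {p : ℕ} (i : Fin p) : Continuous fun v : Fin p → ℝ => softmax v i := by
  unfold softmax
  refine Continuous.div (by fun_prop) (by fun_prop) fun v => ?_
  exact (Finset.sum_pos (fun l _ => Real.exp_pos _) ⟨i, Finset.mem_univ i⟩).ne'

theorem IsNeuralNetwork.continuous {φ : ℝ → ℝ} (hφ : Continuous φ) {m : ℕ}
    {h : (Fin m → ℝ) → ℝ} (hh : IsNeuralNetwork φ m h) : Continuous h := by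
  obtain ⟨p, f, i, hf, rfl | ⟨a, c, rfl⟩ | rfl⟩ := hh
  · exact (continuous_apply i).comp (hf.continuous hφ)
  · have := (continuous_apply i).comp (hf.continuous hφ)
    have := continuous_sigmoid.comp this
    exact (this.const_mul a).add_const c
  · exact (continuous_softmax i).comp (hf.continuous hφ)

theorem sum_mul_sigmoid_mem_Ioo {n : ℕ} {w : Fin n → ℝ} (hw : ∀ j, 0 < w j) (hs : ∑ j, w j = 1)
    (a : Fin n → ℝ) : ∑ j, w j * Real.sigmoid (a j) ∈ Set.Ioo (0 : ℝ) 1 := by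
  have hne : (Finset.univ : Finset (Fin n)).Nonempty := by
    rw [Finset.nonempty_iff_ne_empty]
    intro h
    simp [h] at hs
  constructor
  · exact Finset.sum_pos (fun j _ => mul_pos (hw j) (Real.sigmoid_pos _)) hne
  · rw [← hs]
    exact Finset.sum_lt_sum_of_nonempty hne fun j _ =>
      mul_lt_of_lt_one_right (hw j) (Real.sigmoid_lt_one _)

theorem continuousOn_logit : ContinuousOn logit (Set.Ioo 0 1) := by
  unfold logit
  refine ContinuousOn.log (continuousOn_id.div (by fun_prop) ?_) ?_
  · intro y hy; linarith [hy.2]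
  · intro y hy; exact (div_pos hy.1 (by linarith [hy.2])).ne'

theorem sigmoid_logit {y : ℝ} (hy : y ∈ Set.Ioo (0 : ℝ) 1) : Real.sigmoid (logit y) = y := by
  obtain ⟨t, rfl⟩ := Real.range_sigmoid ▸ hy
  rw [logit_sigmoid]

theorem continuous_before {d : ℕ} (k : Fin d) : Continuous (before k : E d → Fin k → ℝ) := by
  unfold before
  fun_prop

theorem continuous_of_mem_DSF {φ : ℝ → ℝ} (hφ : Continuous φ) {d : ℕ} {g : E d → E d}
    (hg : g ∈ DSF φ d) : Continuous g := by
  obtain ⟨n, w, b, τ, r₀, r₁, r₂, -, hnn, hr, hs, hgx⟩ := hg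
  have key : ∀ k, Continuous fun x => g x k := by
    intro k
    simp_rw [hgx]
    refine continuousOn_logit.comp_continuous (continuous_finsetSum _ fun j _ => ?_) fun x =>
      sum_mul_sigmoid_mem_Ioo (fun j => (hr k j _).2.2) (hs k _) _
    have hb := continuous_before k
    have h1 := ((hnn k j).1.continuous hφ).comp hb
    have h2 := ((hnn k j).2.1.continuous hφ).comp hb
    have h3 := ((hnn k j).2.2.continuous hφ).comp hb
    refine h1.mul (continuous_sigmoid.comp (Continuous.div (.sub (by fun_prop) h2) h3 fun x => ?_))
    exact (hr k j _).2.1.1.ne'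
  exact (PiLp.continuous_toLp 2 _).comp (continuous_pi key)

theorem isLocallyBounded_of_continuous {m n : ℕ} {f : E m → E n} (hf : Continuous f) :
    IsLocallyBounded f := by
  intro x
  refine ⟨f ⁻¹' Metric.ball (f x) 1, hf.continuousAt (Metric.ball_mem_nhds _ one_pos), ?_⟩
  exact Metric.isBounded_ball.subset (Set.image_preimage_subset _ _)

/-! ### Algebra of invertible networks -/

theorem continuous_of_mem_Aff {d : ℕ} {W : E d → E d} (hW : W ∈ Aff d) : Continuous W := by
  obtain ⟨A, b, rfl⟩ := hW
  exact (A.toContinuousLinearEquiv.continuous).add continuous_const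

theorem Aff.comp_mem {d : ℕ} {W V : E d → E d} (hW : W ∈ Aff d) (hV : V ∈ Aff d) :
    W ∘ V ∈ Aff d := by
  obtain ⟨A, b, rfl⟩ := hW
  obtain ⟨B, c, rfl⟩ := hV
  exact ⟨B.trans A, A c + b, by ext1 x; simp [add_assoc]⟩

theorem id_mem_Aff (d : ℕ) : id ∈ Aff d := ⟨.refl ℝ _, 0, by ext1 x; simp⟩

theorem INN.continuous {d : ℕ} {G : Set (E d → E d)} (hG : ∀ g ∈ G, Continuous g)
    {f : E d → E d} (hf : f ∈ INN G) : Continuous f := by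
  change IsINN G f at hf
  induction hf with
  | single hW hg => exact (continuous_of_mem_Aff hW).comp (hG _ hg)
  | cons hW hg _ ih => exact (continuous_of_mem_Aff hW).comp ((hG _ hg).comp ih)

theorem INN.comp_mem {d : ℕ} {G : Set (E d → E d)} {f h : E d → E d} (hf : f ∈ INN G)
    (hh : h ∈ INN G) : f ∘ h ∈ INN G := by
  change IsINN G f at hf
  induction hf with
  | @single W g hW hg => exact IsINN.cons (W := W) (g := g) hW hg hh
  | @cons W g _ hW hg _ ih => exact IsINN.cons (W := W) (g := g) hW hg ih

theorem INN.aff_comp_mem {d : ℕ} {G : Set (E d → E d)} {W f : E d → E d} (hW : W ∈ Aff d)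
    (hf : f ∈ INN G) : W ∘ f ∈ INN G := by
  change IsINN G f at hf
  cases hf with
  | @single V g hV hg => exact IsINN.single (W := W ∘ V) (g := g) (Aff.comp_mem hW hV) hg
  | @cons V g h hV hg hh =>
    exact IsINN.cons (W := W ∘ V) (g := g) (h := h) (Aff.comp_mem hW hV) hg hh

theorem INN.mem_of_mem {d : ℕ} {G : Set (E d → E d)} {g : E d → E d} (hg : g ∈ G) : g ∈ INN G :=
  IsINN.single (W := id) (g := g) (id_mem_Aff d) hg

/-! ### Density of ridge functions -/

section

open MeasureTheory Filter Topology Convolution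

section Ridge

variable {X : Type*} [TopologicalSpace X] [CompactSpace X]

/-- The closed span, in `C(X, ℝ)`, of the functions `φ ∘ (l + b)` with `l ∈ L` and `b ∈ ℝ`. -/
noncomputable def ridgeClosure (φ : C(ℝ, ℝ)) (L : Submodule ℝ C(X, ℝ)) : Submodule ℝ C(X, ℝ) :=
  (Submodule.span ℝ {f | ∃ l ∈ L, ∃ b : ℝ, f = φ.comp (l + .const X b)}).topologicalClosure

theorem isClosed_ridgeClosure (φ : C(ℝ, ℝ)) (L : Submodule ℝ C(X, ℝ)) :
    IsClosed (ridgeClosure φ L : Set C(X, ℝ)) :=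
  Submodule.isClosed_topologicalClosure _

theorem comp_mem_ridgeClosure (φ : C(ℝ, ℝ)) (L : Submodule ℝ C(X, ℝ)) {l : C(X, ℝ)} (hl : l ∈ L)
    (b : ℝ) : φ.comp (l + .const X b) ∈ ridgeClosure φ L :=
  Submodule.le_topologicalClosure _ (Submodule.subset_span ⟨l, hl, b, rfl⟩)

/-- A closed subspace is complete, so the integral can be formed inside it and then carried over by
the inclusion. -/
theorem integral_mem_of_isClosed {V : Type*} [NormedAddCommGroup V] [NormedSpace ℝ V]
    [CompleteSpace V] {N : Submodule ℝ V} (hN : IsClosed (N : Set V)) {F : ℝ → V}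
    (hF : Continuous F) (hc : HasCompactSupport F) (hmem : ∀ t, F t ∈ N) : ∫ t, F t ∈ N := by
  have : CompleteSpace N := hN.completeSpace_coe
  let F' : ℝ → N := fun t => ⟨F t, hmem t⟩
  have hF' : Continuous F' := hF.subtype_mk _
  have hc' : HasCompactSupport F' := by
    refine HasCompactSupport.of_support_subset_isCompact hc fun t ht => subset_closure ?_
    simpa [F', Function.mem_support, Subtype.ext_iff] using ht
  have := N.subtypeL.integral_comp_comm (hF'.integrable_of_hasCompactSupport (μ := volume) hc')
  have h2 : ∫ t, F t = N.subtypeL (∫ t, F' t) := by rw [← this]; rfl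
  rw [h2]
  exact (∫ t, F' t).2

/-- Mollifying the activation costs nothing: `ψ (l + b) = ∫ ρ(t) φ(l + b - t) dt` is a `C(X,
ℝ)`-valued integral of ridge functions. -/
theorem convolution_comp_mem_ridgeClosure (φ : C(ℝ, ℝ)) (L : Submodule ℝ C(X, ℝ))
    (ρ : ContDiffBump (0 : ℝ)) {ψ : C(ℝ, ℝ)}
    (hψ : ∀ s, ψ s = (ρ.normed volume ⋆[ContinuousLinearMap.lsmul ℝ ℝ, volume] φ) s)
    {l : C(X, ℝ)} (hl : l ∈ L) (b : ℝ) : ψ.comp (l + .const X b) ∈ ridgeClosure φ L := by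
  let F : ℝ → C(X, ℝ) := fun t => ρ.normed volume t • φ.comp (l + .const X (b - t))
  have hF : Continuous F := by
    refine Continuous.smul ρ.continuous_normed ?_
    refine ContinuousMap.continuous_of_continuous_uncurry _ ?_
    change Continuous fun p : ℝ × X => φ (l p.2 + (b - p.1))
    fun_prop
  have hc : HasCompactSupport F := ρ.hasCompactSupport_normed.smul_right
  have hint : ∫ t, F t ∈ ridgeClosure φ L :=
    integral_mem_of_isClosed (isClosed_ridgeClosure φ L) hF hc fun t =>
      Submodule.smul_mem _ _ (comp_mem_ridgeClosure φ L hl _)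
  convert! hint using 1
  ext x
  rw [ContinuousMap.integral_apply (hF.integrable_of_hasCompactSupport hc)]
  simp [F, hψ, convolution_def, add_sub_assoc]

/-- Difference quotients in `s` stay in `N`. They converge in sup norm because the curve is the
integral of a continuous `C(X, ℝ)`-valued function, an identity checked pointwise. -/
theorem deriv_comp_mem {N : Submodule ℝ C(X, ℝ)} (hN : IsClosed (N : Set C(X, ℝ)))
    {θ θ' : C(ℝ, ℝ)} (hθ : ∀ s, HasDerivAt θ (θ' s) s) {m l : C(X, ℝ)} {b : ℝ}
    (hmem : ∀ s : ℝ, m * θ.comp (s • l + .const X b) ∈ N) (s : ℝ) :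
    m * l * θ'.comp (s • l + .const X b) ∈ N := by
  let G : ℝ → C(X, ℝ) := fun s => m * θ.comp (s • l + .const X b)
  let G' : ℝ → C(X, ℝ) := fun s => m * l * θ'.comp (s • l + .const X b)
  have hG' : Continuous G' := by
    refine ContinuousMap.continuous_of_continuous_uncurry _ ?_
    change Continuous fun p : ℝ × X => m p.2 * l p.2 * θ' (p.1 * l p.2 + b)
    fun_prop
  have hG : ∀ r, G r = G s + ∫ t in s..r, G' t := by
    intro r
    ext x
    have h1 := (ContinuousMap.evalCLM ℝ x).intervalIntegral_comp_comm
      (hG'.intervalIntegrable (μ := volume) s r)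
    have h2 : ∫ t in s..r, G' t x = G r x - G s x := by
      refine intervalIntegral.integral_eq_sub_of_hasDerivAt (f := fun t => G t x) (fun t _ => ?_) ?_
      · have h3 : HasDerivAt (fun t : ℝ => t * l x + b) (l x) t := by
          simpa using ((hasDerivAt_id t).mul_const (l x)).add_const b
        have h4 := ((hθ (t * l x + b)).comp t h3).const_mul (m x)
        refine h4.congr_deriv ?_
        change _ = m x * l x * θ' (t * l x + b)
        ring
      · exact Continuous.intervalIntegrable
          (((ContinuousMap.evalCLM ℝ x).continuous).comp hG') _ _
    change G r x = G s x + (ContinuousMap.evalCLM ℝ x) (∫ t in s..r, G' t)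
    rw [← h1]
    change G r x = G s x + ∫ t in s..r, G' t x
    rw [h2]; ring
  have hd : HasDerivAt G (G' s) s := by
    have := (hG'.integral_hasStrictDerivAt s s).hasDerivAt.const_add (G s)
    rwa [← funext hG] at this
  rw [hasDerivAt_iff_tendsto_slope] at hd
  refine hN.mem_of_tendsto hd (Eventually.of_forall fun r => ?_)
  exact N.smul_mem _ (N.sub_mem (hmem r) (hmem s))

theorem pow_mul_iteratedDeriv_comp_mem {N : Submodule ℝ C(X, ℝ)}
    (hN : IsClosed (N : Set C(X, ℝ))) {θ : ℝ → ℝ} (hθ : ContDiff ℝ (⊤ : ℕ∞) θ) {l : C(X, ℝ)}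
    {b : ℝ} (hmem : ∀ s : ℝ, (⟨θ, hθ.continuous⟩ : C(ℝ, ℝ)).comp (s • l + .const X b) ∈ N)
    (k : ℕ) (s : ℝ) :
    l ^ k * (⟨iteratedDeriv k θ, hθ.continuous_iteratedDeriv k (mod_cast le_top)⟩ : C(ℝ, ℝ)).comp
      (s • l + .const X b) ∈ N := by
  induction k generalizing s with
  | zero => simpa using hmem s
  | succ k ih =>
    have := deriv_comp_mem (θ' := ⟨iteratedDeriv (k + 1) θ,
      hθ.continuous_iteratedDeriv (k + 1) (mod_cast le_top)⟩) hN (fun t => ?_) ih s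
    · simpa only [pow_succ] using this
    · have h1 : Differentiable ℝ (iteratedDeriv k θ) :=
        hθ.differentiable_iteratedDeriv k (mod_cast WithTop.coe_lt_top _)
      simpa [iteratedDeriv_succ] using (h1 t).hasDerivAt

end Ridge

theorem mem_span_pow_of_iteratedDeriv_eq_zero (n : ℕ) {f : ℝ → ℝ} (hf : ContDiff ℝ (⊤ : ℕ∞) f)
    (h0 : ∀ x, iteratedDeriv n f x = 0) :
    f ∈ Submodule.span ℝ (Set.range fun (i : Fin n) (x : ℝ) => x ^ (i : ℕ)) := by
  induction n generalizing f with
  | zero =>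
    have : f = 0 := funext fun x => by simpa using h0 x
    rw [this]
    exact Submodule.zero_mem _
  | succ n ih =>
    have hd : ContDiff ℝ (⊤ : ℕ∞) (deriv f) := by
      have : ContDiff ℝ ((⊤ : ℕ∞) + 1) f := hf
      exact (contDiff_succ_iff_deriv.1 this).2.2
    obtain ⟨c, hc⟩ := (Submodule.mem_span_range_iff_exists_fun ℝ).1
      (ih hd fun x => by simpa [iteratedDeriv_succ'] using h0 x)
    let P : ℝ → ℝ := fun x => ∑ i, c i / (i + 1) * x ^ ((i : ℕ) + 1)
    have hP : ∀ x, HasDerivAt P (deriv f x) x := by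
      intro x
      have : ∀ i ∈ (Finset.univ : Finset (Fin n)), HasDerivAt
          (fun x : ℝ => c i / (i + 1) * x ^ ((i : ℕ) + 1)) (c i * x ^ (i : ℕ)) x := by
        intro i _
        refine ((hasDerivAt_pow ((i : ℕ) + 1) x).const_mul (c i / (i + 1))).congr_deriv ?_
        have : ((i : ℕ) + 1 : ℝ) ≠ 0 := by positivity
        push_cast
        field_simp
      refine (HasDerivAt.fun_sum this).congr_deriv ?_
      rw [← hc]
      simp
    have hconst : ∀ x, f x = f 0 - P 0 + P x := by
      intro x
      have hdf : Differentiable ℝ f := hf.differentiable (by simp)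
      have : f x - P x = f 0 - P 0 := is_const_of_deriv_eq_zero (f := f - P)
        (hdf.sub fun x => (hP x).differentiableAt)
        (fun x => by rw [((hdf x).hasDerivAt.sub (hP x)).deriv]; ring) x 0
      linarith
    rw [Submodule.mem_span_range_iff_exists_fun]
    refine ⟨Fin.cons (f 0 - P 0) fun i => c i / (i + 1), ?_⟩
    ext x
    rw [hconst x, Fin.sum_univ_succ]
    simp [P, Finset.sum_apply]

/-- Otherwise every mollification of `φ` is a polynomial of degree below `k`. These form a
finite-dimensional subspace, closed under pointwise limits, so `φ` would be a polynomial too. -/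
theorem exists_bump_iteratedDeriv_ne_zero {φ : ℝ → ℝ} (hφ : Continuous φ)
    (hpoly : ¬ ∃ p : Polynomial ℝ, ∀ x, φ x = p.eval x) (k : ℕ) :
    ∃ (ρ : ContDiffBump (0 : ℝ)) (b : ℝ),
      iteratedDeriv k (ρ.normed volume ⋆[ContinuousLinearMap.lsmul ℝ ℝ, volume] φ) b ≠ 0 := by
  by_contra! hcon
  let ρ : ℕ → ContDiffBump (0 : ℝ) := fun i =>
    ⟨1 / (i + 1) / 2, 1 / (i + 1), by positivity, by
      have : (0 : ℝ) < 1 / ((i : ℝ) + 1) := by positivity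
      linarith⟩
  have hfin : FiniteDimensional ℝ
      (Submodule.span ℝ (Set.range fun (i : Fin k) (x : ℝ) => x ^ (i : ℕ))) :=
    FiniteDimensional.span_of_finite ℝ (Set.finite_range _)
  have hclosed := Submodule.closed_of_finiteDimensional
    (Submodule.span ℝ (Set.range fun (i : Fin k) (x : ℝ) => x ^ (i : ℕ)))
  have hlim : Tendsto (fun i => (ρ i).normed volume ⋆[ContinuousLinearMap.lsmul ℝ ℝ, volume] φ)
      atTop (𝓝 φ) := by
    rw [tendsto_pi_nhds]
    intro x
    refine ContDiffBump.convolution_tendsto_right_of_continuous ?_ hφ x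
    exact tendsto_one_div_add_atTop_nhds_zero_nat
  have hmem := hclosed.mem_of_tendsto hlim (Eventually.of_forall fun i =>
    mem_span_pow_of_iteratedDeriv_eq_zero k
      ((ρ i).hasCompactSupport_normed.contDiff_convolution_left _ (ρ i).contDiff_normed
        hφ.locallyIntegrable) (hcon (ρ i)))
  obtain ⟨c, hc⟩ := (Submodule.mem_span_range_iff_exists_fun ℝ).1 hmem
  refine hpoly ⟨∑ i : Fin k, Polynomial.C (c i) * Polynomial.X ^ (i : ℕ), fun x => ?_⟩
  rw [← hc]
  simp [Polynomial.eval_finsetSum, Finset.sum_apply]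

section Density

variable {X : Type*} [TopologicalSpace X] [CompactSpace X]

theorem pow_mem_ridgeClosure {φ : C(ℝ, ℝ)} (hpoly : ¬ ∃ p : Polynomial ℝ, ∀ x, φ x = p.eval x)
    {L : Submodule ℝ C(X, ℝ)} {l : C(X, ℝ)} (hl : l ∈ L) (k : ℕ) :
    l ^ k ∈ ridgeClosure φ L := by
  obtain ⟨ρ, b, hb⟩ := exists_bump_iteratedDeriv_ne_zero φ.continuous hpoly k
  have hψ : ContDiff ℝ (⊤ : ℕ∞)
      (ρ.normed volume ⋆[ContinuousLinearMap.lsmul ℝ ℝ, volume] φ) :=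
    ρ.hasCompactSupport_normed.contDiff_convolution_left _ ρ.contDiff_normed
      φ.continuous.locallyIntegrable
  -- At `s = 0` the `k`-th derivative of `s ↦ ψ (s l + b)` is `l ^ k` times the nonzero constant
  -- `ψ⁽ᵏ⁾(b)`.
  have := pow_mul_iteratedDeriv_comp_mem (isClosed_ridgeClosure φ L) hψ (l := l) (b := b)
    (fun s => convolution_comp_mem_ridgeClosure φ L ρ (fun _ => rfl) (L.smul_mem s hl) b) k 0
  have h2 := (ridgeClosure φ L).smul_mem (iteratedDeriv k
    (ρ.normed volume ⋆[ContinuousLinearMap.lsmul ℝ ℝ, volume] φ) b)⁻¹ this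
  convert h2 using 1
  ext x
  simp only [ContinuousMap.pow_apply, ContinuousMap.smul_apply, ContinuousMap.mul_apply,
    ContinuousMap.comp_apply, ContinuousMap.const_apply, ContinuousMap.coe_mk, zero_smul, zero_add, smul_eq_mul]
  field_simp

/-- Powers of `l` give `exp l` through its series. Exponentials of elements of `L` are closed under
products, so their span is an algebra, and Stone–Weierstrass applies. -/
theorem ridgeClosure_eq_top {φ : C(ℝ, ℝ)} (hpoly : ¬ ∃ p : Polynomial ℝ, ∀ x, φ x = p.eval x)
    {L : Submodule ℝ C(X, ℝ)} (hL : ∀ x y : X, x ≠ y → ∃ l ∈ L, l x ≠ l y) :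
    ridgeClosure φ L = ⊤ := by
  have hexp : ∀ l ∈ L, NormedSpace.exp l ∈ ridgeClosure φ L := by
    intro l hl
    refine (isClosed_ridgeClosure φ L).mem_of_tendsto
      (NormedSpace.exp_series_hasSum_exp' (𝕂 := ℝ) l) (Eventually.of_forall fun s => ?_)
    exact Submodule.sum_mem _ fun k _ =>
      Submodule.smul_mem _ _ (pow_mem_ridgeClosure hpoly hl k)
  let M : Submonoid C(X, ℝ) :=
    { carrier := {f | ∃ l ∈ L, f = NormedSpace.exp l}
      one_mem' := ⟨0, L.zero_mem, NormedSpace.exp_zero.symm⟩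
      mul_mem' := by
        rintro _ _ ⟨l, hl, rfl⟩ ⟨l', hl', rfl⟩
        exact ⟨l + l', L.add_mem hl hl', NormedSpace.exp_add.symm⟩ }
  let A : Subalgebra ℝ C(X, ℝ) := Algebra.adjoin ℝ (M : Set C(X, ℝ))
  have hA : Subalgebra.toSubmodule A ≤ ridgeClosure φ L := by
    rw [Algebra.adjoin_eq_span, Submonoid.closure_eq, Submodule.span_le]
    rintro _ ⟨l, hl, rfl⟩
    exact hexp l hl
  have hsep : A.SeparatesPoints := by
    intro x y hxy
    obtain ⟨l, hl, hne⟩ := hL x y hxy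
    refine ⟨_, ⟨NormedSpace.exp l, Algebra.subset_adjoin ⟨l, hl, rfl⟩, rfl⟩, ?_⟩
    have hev : ∀ z, (NormedSpace.exp l : C(X, ℝ)) z = Real.exp (l z) := by
      intro z
      rw [Real.exp_eq_exp_ℝ]
      exact NormedSpace.map_exp (ContinuousMap.evalAlgHom ℝ ℝ z)
        (ContinuousMap.evalCLM ℝ z).continuous l
    change (NormedSpace.exp l : C(X, ℝ)) x ≠ (NormedSpace.exp l : C(X, ℝ)) y
    rw [hev, hev]
    exact fun h => hne (Real.exp_injective h)
  have htop := ContinuousMap.subalgebra_topologicalClosure_eq_top_of_separatesPoints A hsep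
  rw [eq_top_iff]
  intro f _
  have hf : f ∈ A.topologicalClosure := by rw [htop]; trivial
  exact closure_minimal hA (isClosed_ridgeClosure φ L) hf

end Density

end

/-! ### Universal approximation by multi-layer perceptrons -/

/-- The linear form with coefficient vector `a`, restricted to `K`. -/
noncomputable def linearFormOn {m : ℕ} (K : Set (Fin m → ℝ)) : (Fin m → ℝ) →ₗ[ℝ] C(K, ℝ) where
  toFun a := ⟨fun x => ∑ i, a i * x.1 i, continuous_finsetSum _ fun i _ =>
    continuous_const.mul ((continuous_apply i).comp continuous_subtype_val)⟩
  map_add' a b := by ext x; simp [add_mul, Finset.sum_add_distrib]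
  map_smul' c a := by ext x; simp [Finset.mul_sum, mul_assoc]

theorem exists_finsupp_ridge_approx {φ : C(ℝ, ℝ)}
    (hpoly : ¬ ∃ p : Polynomial ℝ, ∀ x, φ x = p.eval x) {m : ℕ} {K : Set (Fin m → ℝ)}
    (hK : IsCompact K) {h : (Fin m → ℝ) → ℝ} (hc : Continuous h) {ε : ℝ} (hε : 0 < ε) :
    ∃ c : ((Fin m → ℝ) × ℝ) →₀ ℝ,
      ∀ x ∈ K, |(c.sum fun p r => r * φ (∑ i, p.1 i * x i + p.2)) - h x| < ε := by
  have : CompactSpace K := isCompact_iff_compactSpace.1 hK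
  have htop : ridgeClosure φ (LinearMap.range (linearFormOn K)) = ⊤ := by
    refine ridgeClosure_eq_top hpoly fun x y hxy => ?_
    obtain ⟨i, hi⟩ := Function.ne_iff.1 (fun h => hxy (Subtype.ext h))
    refine ⟨_, ⟨Pi.single i 1, rfl⟩, ?_⟩
    simpa [linearFormOn, Pi.single_apply] using hi
  let g : C(K, ℝ) := ⟨fun x => h x.1, by fun_prop⟩
  have hg : g ∈ ridgeClosure φ (LinearMap.range (linearFormOn K)) := by rw [htop]; trivial
  obtain ⟨s, hs, hgs⟩ := Metric.mem_closure_iff.1 hg ε hε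
  have hset : {f | ∃ l ∈ LinearMap.range (linearFormOn K), ∃ b : ℝ,
      f = φ.comp (l + .const K b)} = Set.range fun p : (Fin m → ℝ) × ℝ =>
        φ.comp (linearFormOn K p.1 + .const K p.2) := by
    ext f
    constructor
    · rintro ⟨_, ⟨a, rfl⟩, b, rfl⟩
      exact ⟨(a, b), rfl⟩
    · rintro ⟨⟨a, b⟩, rfl⟩
      exact ⟨_, ⟨a, rfl⟩, b, rfl⟩
  rw [hset] at hs
  obtain ⟨c, rfl⟩ := Finsupp.mem_span_range_iff_exists_finsupp.1 hs
  refine ⟨c, fun x hx => ?_⟩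
  have h1 := (ContinuousMap.dist_lt_iff hε).1 hgs ⟨x, hx⟩
  rw [dist_comm, Real.dist_eq] at h1
  have h2 : (c.sum fun p r => r • φ.comp (linearFormOn K p.1 + .const K p.2)) ⟨x, hx⟩ =
      c.sum fun p r => r * φ (∑ i, p.1 i * x i + p.2) := by
    simp [Finsupp.sum, linearFormOn]
  rwa [h2] at h1

theorem exists_isMLP_approx {φ : ℝ → ℝ} (hφ : Continuous φ)
    (hpoly : ¬ ∃ p : Polynomial ℝ, ∀ x, φ x = p.eval x) {m n : ℕ} {K : Set (Fin m → ℝ)}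
    (hK : IsCompact K) {h : Fin n → (Fin m → ℝ) → ℝ} (hc : ∀ j, Continuous (h j)) {ε : ℝ}
    (hε : 0 < ε) : ∃ f, IsMLP φ m n f ∧ ∀ x ∈ K, ∀ j, |f x j - h j x| < ε := by
  classical
  choose c hcapp using fun j =>
    exists_finsupp_ridge_approx (φ := ⟨φ, hφ⟩) hpoly hK (hc j) hε
  -- All outputs share one hidden layer, whose units are the ridge directions used by any of them.
  let T : Finset ((Fin m → ℝ) × ℝ) := Finset.univ.biUnion fun j => (c j).support
  let e := T.equivFin
  refine ⟨_, .layer (.affine (.of fun i k => (e.symm i).1.1 k) fun i => (e.symm i).1.2)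
    (.of fun j i => c j (e.symm i).1) 0, fun x hx j => ?_⟩
  convert! hcapp j x hx using 3
  rw [Finsupp.sum_of_support_subset (s := T) _
    (Finset.subset_biUnion_of_mem (fun j => (c j).support) (Finset.mem_univ j)) _ (by simp),
    ← Finset.sum_coe_sort T, ← e.symm.sum_comp]
  simp [Matrix.mulVec, dotProduct]

/-! ### Deep sigmoidal flows approximate triangular increasing maps -/

theorem isNeuralNetwork_const (φ : ℝ → ℝ) (m : ℕ) (r : ℝ) :
    IsNeuralNetwork φ m fun _ => r :=
  ⟨1, _, 0, .affine 0 fun _ => r, .inl (by ext x; simp)⟩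

/-- Bound `s j` below by the indicator of `j < i` minus `e`. The increments telescope to `V i` over
`j < i` and to `1` in all. -/
theorem sub_le_sum_increments_mul {n i : ℕ} {V s : ℕ → ℝ} {e : ℝ}
    (hV : ∀ j < n, V j < V (j + 1)) (hV0 : V 0 = 0) (hVn : V n = 1) (hi : i ≤ n)
    (hs0 : ∀ j, 0 ≤ s j) (he : 0 ≤ e) (hs : ∀ j < i, 1 - e ≤ s j) :
    V i - e ≤ ∑ j ∈ Finset.range n, (V (j + 1) - V j) * s j := by
  have h1 : ∑ j ∈ Finset.range n, (V (j + 1) - V j) * ((if j < i then 1 else 0) - e) ≤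
      ∑ j ∈ Finset.range n, (V (j + 1) - V j) * s j := by
    refine Finset.sum_le_sum fun j hj => ?_
    refine mul_le_mul_of_nonneg_left ?_ (sub_nonneg.2 (hV j (Finset.mem_range.1 hj)).le)
    split_ifs with h
    · exact hs j h
    · linarith [hs0 j]
  refine le_trans (le_of_eq ?_) h1
  have h2 : (Finset.range n).filter (fun j => j < i) = Finset.range i := by
    ext j; simp only [Finset.mem_filter, Finset.mem_range]; omega
  simp_rw [mul_sub, Finset.sum_sub_distrib, ← Finset.sum_mul, mul_ite, mul_one, mul_zero,
    ← Finset.sum_filter, h2, Finset.sum_sub_distrib]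
  rw [← Finset.sum_sub_distrib, ← Finset.sum_sub_distrib, Finset.sum_range_sub,
    Finset.sum_range_sub, hV0, hVn]
  ring

theorem sum_increments_mul_le_add {n i : ℕ} {V s : ℕ → ℝ} {e : ℝ}
    (hV : ∀ j < n, V j < V (j + 1)) (hV0 : V 0 = 0) (hVn : V n = 1) (hi : i ≤ n)
    (hs1 : ∀ j, s j ≤ 1) (he : 0 ≤ e) (hs : ∀ j, i ≤ j → s j ≤ e) :
    ∑ j ∈ Finset.range n, (V (j + 1) - V j) * s j ≤ V i + e := by
  have h1 : ∑ j ∈ Finset.range n, (V (j + 1) - V j) * s j ≤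
      ∑ j ∈ Finset.range n, (V (j + 1) - V j) * ((if j < i then 1 else 0) + e) := by
    refine Finset.sum_le_sum fun j hj => ?_
    refine mul_le_mul_of_nonneg_left ?_ (sub_nonneg.2 (hV j (Finset.mem_range.1 hj)).le)
    split_ifs with h
    · linarith [hs1 j]
    · linarith [hs j (not_lt.1 h)]
  refine h1.trans (le_of_eq ?_)
  have h2 : (Finset.range n).filter (fun j => j < i) = Finset.range i := by
    ext j; simp only [Finset.mem_filter, Finset.mem_range]; omega
  simp_rw [mul_add, Finset.sum_add_distrib, ← Finset.sum_mul, mul_ite, mul_one, mul_zero,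
    ← Finset.sum_filter, h2]
  rw [Finset.sum_range_sub, Finset.sum_range_sub, hV0, hVn]
  ring

/-- Softmax of `log W` is `W`. An error `κ` in the logarithms changes numerator and denominator each
by a factor within `exp (±κ)`. -/
theorem abs_softmax_sub_le {n : ℕ} {W l : Fin n → ℝ} {κ : ℝ} (hW : ∀ j, 0 < W j)
    (hs : ∑ j, W j = 1) (hl : ∀ j, |l j - Real.log (W j)| ≤ κ) (j : Fin n) :
    |softmax l j - W j| ≤ (Real.exp (2 * κ) - 1) * W j := by
  have hup : ∀ j, Real.exp (l j) ≤ Real.exp κ * W j := fun j => by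
    nth_rw 1 [← Real.exp_log (hW j)]
    rw [← Real.exp_add]
    exact Real.exp_le_exp.2 (by linarith [(abs_le.1 (hl j)).2])
  have hlow : ∀ j, Real.exp (-κ) * W j ≤ Real.exp (l j) := fun j => by
    nth_rw 1 [← Real.exp_log (hW j)]
    rw [← Real.exp_add]
    exact Real.exp_le_exp.2 (by linarith [(abs_le.1 (hl j)).1])
  have hSup : ∑ j, Real.exp (l j) ≤ Real.exp κ := by
    calc _ ≤ ∑ j, Real.exp κ * W j := Finset.sum_le_sum fun j _ => hup j
      _ = _ := by rw [← Finset.mul_sum, hs, mul_one]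
  have hSlow : Real.exp (-κ) ≤ ∑ j, Real.exp (l j) := by
    calc _ = ∑ j, Real.exp (-κ) * W j := by rw [← Finset.mul_sum, hs, mul_one]
      _ ≤ _ := Finset.sum_le_sum fun j _ => hlow j
  have hSpos : 0 < ∑ j, Real.exp (l j) := (Real.exp_pos _).trans_le hSlow
  have hE : Real.exp (2 * κ) * Real.exp (-κ) = Real.exp κ := by
    rw [← Real.exp_add]; ring_nf
  have hE' : Real.exp (-(2 * κ)) * Real.exp κ = Real.exp (-κ) := by
    rw [← Real.exp_add]; ring_nf
  have h1 : softmax l j ≤ Real.exp (2 * κ) * W j := by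
    rw [softmax, div_le_iff₀ hSpos]
    calc _ ≤ Real.exp κ * W j := hup j
      _ = Real.exp (2 * κ) * W j * Real.exp (-κ) := by rw [← hE]; ring
      _ ≤ _ := mul_le_mul_of_nonneg_left hSlow (mul_nonneg (Real.exp_pos _).le (hW j).le)
  have h2 : Real.exp (-(2 * κ)) * W j ≤ softmax l j := by
    rw [softmax, le_div_iff₀ hSpos]
    calc _ ≤ Real.exp (-(2 * κ)) * W j * Real.exp κ :=
          mul_le_mul_of_nonneg_left hSup (mul_nonneg (Real.exp_pos _).le (hW j).le)
      _ = Real.exp (-κ) * W j := by rw [← hE']; ring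
      _ ≤ _ := hlow j
  have h3 : 2 ≤ Real.exp (2 * κ) + Real.exp (-(2 * κ)) := by
    linarith [Real.add_one_le_exp (2 * κ), Real.add_one_le_exp (-(2 * κ))]
  rw [abs_le]
  constructor
  · nlinarith [hW j]
  · linarith

theorem exists_abs_logit_sub_lt (B : ℝ) {ε : ℝ} (hε : 0 < ε) :
    ∃ η > 0, ∀ r ∈ Set.Icc (-B) B, ∀ s ∈ Set.Ioo (0 : ℝ) 1,
      |s - Real.sigmoid r| < η → |logit s - r| < ε := by
  have hcont := continuous_sigmoid
  -- `η` bounds below the gaps `σ(r + ε) - σ(r)` and `σ(r) - σ(r - ε)`, which are positive and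
  -- continuous on a compact interval.
  obtain ⟨η, hη, hle⟩ := (isCompact_Icc (a := -B) (b := B)).exists_forall_le'
    (f := fun r => min (Real.sigmoid (r + ε) - Real.sigmoid r)
      (Real.sigmoid r - Real.sigmoid (r - ε))) (a := 0) (by fun_prop) (fun r _ => by
        refine lt_min (sub_pos.2 (Real.sigmoid_lt (by linarith)))
          (sub_pos.2 (Real.sigmoid_lt (by linarith))))
  refine ⟨η, hη, fun r hr s hs hsr => ?_⟩
  have h := hle r hr
  rw [le_min_iff] at h
  rw [abs_lt] at hsr ⊢
  rw [← sigmoid_logit hs] at hsr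
  have h1 : Real.sigmoid (logit s) < Real.sigmoid (r + ε) := by linarith
  have h2 : Real.sigmoid (r - ε) < Real.sigmoid (logit s) := by linarith
  rw [Real.sigmoid_lt_iff] at h1 h2
  constructor <;> linarith

theorem exists_sigmoid_large {e : ℝ} (he : 0 < e) :
    ∃ A > 0, 1 - e ≤ Real.sigmoid A ∧ Real.sigmoid (-A) ≤ e := by
  have h := Real.tendsto_sigmoid_atTop.eventually (lt_mem_nhds (show 1 - e < 1 by linarith))
  obtain ⟨A, hA, hA0⟩ := (h.and (Filter.eventually_gt_atTop 0)).exists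
  exact ⟨A, hA0, hA.le, by rw [Real.sigmoid_neg]; linarith⟩

/-- A step-like mixture of steep sigmoids centred on an equidistant grid, whose weights are the
increments of `v`, approximates the increasing function `v`. -/
theorem exists_sigmoid_mixture_approx {Y : Type*} [PseudoMetricSpace Y] {v : Y → ℝ → ℝ}
    (hv : Continuous fun p : Y × ℝ => v p.1 p.2) (hmono : ∀ y, StrictMono (v y))
    (h0 : ∀ y t, 0 < v y t) (h1 : ∀ y t, v y t < 1) {K : Set Y} (hK : IsCompact K) (M : ℝ)
    {η : ℝ} (hη : 0 < η) :
    ∃ n₀ : ℕ, ∀ n ≥ n₀, ∃ (W : Fin n → Y → ℝ) (b : Fin n → ℝ) (τ : ℝ), 0 < τ ∧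
      (∀ j, Continuous (W j)) ∧ (∀ j y, 0 < W j y) ∧ (∀ y, ∑ j, W j y = 1) ∧
      ∀ y ∈ K, ∀ t ∈ Set.Icc (-M) M,
        |∑ j, W j y * Real.sigmoid ((t - b j) / τ) - v y t| ≤ η := by
  have he : 0 < η / 2 := by linarith
  obtain ⟨A, hA, hA1, hA2⟩ := exists_sigmoid_large he
  have huc := (hK.prod (isCompact_Icc (a := -M - 2) (b := M + 2))).uniformContinuousOn_of_continuous
    hv.continuousOn
  rw [Metric.uniformContinuousOn_iff] at huc
  obtain ⟨δ', hδ', hδ⟩ := huc (η / 2) he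
  obtain ⟨δ, hδ0, hδ1, hδδ⟩ : ∃ δ > 0, δ ≤ 1 ∧ 2 * δ < δ' :=
    ⟨min 1 (δ' / 3), by positivity, min_le_left _ _, by
      linarith [min_le_right 1 (δ' / 3)]⟩
  have hvc : ∀ y ∈ K, ∀ t ∈ Set.Icc (-M) M, ∀ t', |t' - t| ≤ 2 * δ →
      |v y t' - v y t| < η / 2 := by
    intro y hy t ht t' htt
    have h2 := abs_le.1 htt
    have := hδ (y, t') ⟨hy, by constructor <;> linarith [ht.1, ht.2]⟩ (y, t)
      ⟨hy, by constructor <;> linarith [ht.1, ht.2]⟩ (by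
        rw [Prod.dist_eq, dist_self, Real.dist_eq]
        exact max_lt hδ' (htt.trans_lt hδδ))
    rwa [Real.dist_eq] at this
  let c : ℕ → ℝ := fun j => -M - 3 * δ + j * δ
  have hc : ∀ j, c (j + 1) = c j + δ := fun j => by simp only [c]; push_cast; ring
  have hcm : StrictMono c := strictMono_nat_of_lt_succ fun j => by rw [hc]; linarith
  refine ⟨⌈2 * M / δ⌉₊ + 6, fun n hn => ?_⟩
  -- The end values are forced to `0` and `1` so that the increments sum to `1`. The grid overshoots
  -- `[-M, M]`, so these ends are never used as values of `v` below.
  let V : Y → ℕ → ℝ := fun y j => if j = 0 then 0 else if j < n then v y (c j) else 1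
  have hV : ∀ y, ∀ j < n, V y j < V y (j + 1) := by
    intro y j hj
    by_cases hj0 : j = 0
    · have : 0 + 1 < n := by omega
      simp only [V, hj0, this, if_true, Nat.succ_ne_zero, if_false]
      exact h0 y _
    · by_cases hj1 : j + 1 < n
      · simp only [V, hj0, hj, hj1, if_true, Nat.succ_ne_zero, if_false]
        exact hmono y (hcm (Nat.lt_succ_self j))
      · simp only [V, hj0, hj, hj1, if_true, Nat.succ_ne_zero, if_false]
        exact h1 y _
  have hV0 : ∀ y, V y 0 = 0 := fun y => by simp [V]
  have hVn : ∀ y, V y n = 1 := fun y => by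
    have : n ≠ 0 := by omega
    simp [V, this]
  have hVc : ∀ j, Continuous fun y => V y j := by
    intro j
    have : Continuous fun y => v y (c j) := hv.comp (by fun_prop : Continuous fun y => (y, c j))
    simp only [V]
    split_ifs <;> fun_prop
  refine ⟨fun j y => V y (j + 1) - V y j, fun j => c (j + 1), δ / A, by positivity,
    fun j => (hVc _).sub (hVc _), fun j y => sub_pos.2 (hV y j j.2), fun y => ?_,
    fun y hy t ht => ?_⟩
  · rw [Fin.sum_univ_eq_sum_range (fun j => V y (j + 1) - V y j), Finset.sum_range_sub, hV0, hVn,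
      sub_zero]
  · rw [Fin.sum_univ_eq_sum_range
      (fun j => (V y (j + 1) - V y j) * Real.sigmoid ((t - c (j + 1)) / (δ / A)))]
    -- This makes `t - 2δ < c i ≤ t - δ`. With width `δ / A`, sigmoids `j < i` are nearly `1` at `t`
    -- and those with `j ≥ i + 2` nearly `0`, so the mixture lies between `V y i` and `V y (i + 2)`
    -- up to `η / 2`.
    let i := ⌊(t + M + 2 * δ) / δ⌋₊
    have hq : 2 ≤ (t + M + 2 * δ) / δ := by rw [le_div_iff₀ hδ0]; linarith [ht.1]
    have hi2 : 2 ≤ i := Nat.le_floor (by exact_mod_cast hq)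
    have hile : (i : ℝ) ≤ (t + M + 2 * δ) / δ := Nat.floor_le (by linarith)
    have hilt : (t + M + 2 * δ) / δ < i + 1 := Nat.lt_floor_add_one _
    rw [le_div_iff₀ hδ0] at hile
    rw [div_lt_iff₀ hδ0] at hilt
    have hin : i + 3 < n := by
      have h2 : (i : ℝ) ≤ 2 * M / δ + 2 := by
        rw [div_add' _ _ _ hδ0.ne', le_div_iff₀ hδ0]
        linarith [ht.2]
      have h3 : (i : ℝ) ≤ (⌈2 * M / δ⌉₊ + 2 : ℕ) := by
        push_cast
        linarith [Nat.le_ceil (2 * M / δ)]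
      have h4 : i ≤ ⌈2 * M / δ⌉₊ + 2 := by exact_mod_cast h3
      omega
    have hci : c i ≤ t - δ := by simp only [c]; linarith
    have hci' : t - 2 * δ ≤ c i := by simp only [c]; linarith
    have hci2 : c (i + 2) = c i + 2 * δ := by rw [hc, hc]; ring
    have hlow := sub_le_sum_increments_mul (i := i) (hV y) (hV0 y) (hVn y) (by omega)
      (s := fun j => Real.sigmoid ((t - c (j + 1)) / (δ / A)))
      (fun j => Real.sigmoid_nonneg _) he.le (fun j hj => by
        refine hA1.trans (Real.sigmoid_le ?_)
        rw [le_div_iff₀ (by positivity), mul_div_cancel₀ _ hA.ne']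
        have : c (j + 1) ≤ c i := hcm.monotone hj
        linarith)
    have hup := sum_increments_mul_le_add (i := i + 2) (hV y) (hV0 y) (hVn y) (by omega)
      (s := fun j => Real.sigmoid ((t - c (j + 1)) / (δ / A)))
      (fun j => Real.sigmoid_le_one _) he.le (fun j hj => by
        refine (Real.sigmoid_le ?_).trans hA2
        rw [div_le_iff₀ (by positivity), neg_mul, mul_div_cancel₀ _ hA.ne']
        have : c (i + 3) ≤ c (j + 1) := hcm.monotone (by omega)
        rw [hc (i + 2)] at this
        linarith)
    have hVi : V y i = v y (c i) := by
      have h2 : i ≠ 0 := by omega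
      have h3 : i < n := by omega
      simp [V, h2, h3]
    have hVi2 : V y (i + 2) = v y (c (i + 2)) := by
      have h3 : i + 2 < n := by omega
      simp [V, h3]
    have e1 := abs_lt.1 (hvc y hy t ht (c i) (abs_le.2 ⟨by linarith, by linarith⟩))
    have e2 := abs_lt.1 (hvc y hy t ht (c (i + 2)) (abs_le.2 ⟨by linarith, by linarith⟩))
    rw [hVi] at hlow
    rw [hVi2] at hup
    rw [abs_le]
    constructor <;> linarith

/-- Softmax keeps the weights positive with sum `1` everywhere, though they approximate only on `K`.
Every large `n` is allowed because all coordinates of a flow must use the same number of sigmoids.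
-/
theorem exists_flow_coordinate_approx {φ : ℝ → ℝ} (hφ : Continuous φ)
    (hpoly : ¬ ∃ p : Polynomial ℝ, ∀ x, φ x = p.eval x) {m : ℕ} {u : (Fin m → ℝ) → ℝ → ℝ}
    (hu : Continuous fun p : (Fin m → ℝ) × ℝ => u p.1 p.2) (hmono : ∀ y, StrictMono (u y))
    {K : Set (Fin m → ℝ)} (hK : IsCompact K) (M : ℝ) {ε : ℝ} (hε : 0 < ε) :
    ∃ n₀ : ℕ, ∀ n ≥ n₀, ∃ (w : Fin n → (Fin m → ℝ) → ℝ) (b : Fin n → ℝ) (τ : ℝ), 0 < τ ∧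
      (∀ j, IsNeuralNetwork φ m (w j)) ∧ (∀ j y, 0 < w j y) ∧ (∀ y, ∑ j, w j y = 1) ∧
      ∀ y ∈ K, ∀ t ∈ Set.Icc (-M) M,
        |logit (∑ j, w j y * Real.sigmoid ((t - b j) / τ)) - u y t| < ε := by
  obtain ⟨B, hB⟩ := ((hK.prod (isCompact_Icc (a := -M) (b := M))).image hu).isBounded.exists_norm_le
  obtain ⟨η, hη, hlogit⟩ := exists_abs_logit_sub_lt B hε
  obtain ⟨n₀, hn₀⟩ := exists_sigmoid_mixture_approx (v := fun y t => Real.sigmoid (u y t))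
    (continuous_sigmoid.comp hu) (fun y => Real.sigmoid_strictMono.comp (hmono y))
    (fun y t => Real.sigmoid_pos _) (fun y t => Real.sigmoid_lt_one _) hK M
    (show 0 < η / 4 by linarith)
  refine ⟨n₀ + 1, fun n hn => ?_⟩
  obtain ⟨W, b, τ, hτ, hWc, hW, hWs, hWv⟩ := hn₀ n (by omega)
  -- Chosen so that the relative softmax error `exp (2κ) - 1` equals `η / 4`.
  let κ := Real.log (1 + η / 4) / 2
  have hκ : 0 < κ := half_pos (Real.log_pos (by linarith))
  have hexp : Real.exp (2 * κ) - 1 = η / 4 := by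
    rw [show 2 * κ = Real.log (1 + η / 4) by simp only [κ]; ring, Real.exp_log (by linarith)]
    ring
  obtain ⟨f, hf, hfapp⟩ := exists_isMLP_approx hφ hpoly hK
    (h := fun j y => Real.log (W j y)) (fun j => (hWc j).log fun y => (hW j y).ne') hκ
  have hpos : ∀ y, 0 < ∑ l, Real.exp (f y l) := fun y =>
    Finset.sum_pos (fun l _ => Real.exp_pos _) ⟨⟨0, by omega⟩, Finset.mem_univ _⟩
  have hwpos : ∀ j y, 0 < softmax (f y) j := fun j y => div_pos (Real.exp_pos _) (hpos y)
  have hwsum : ∀ y, ∑ j, softmax (f y) j = 1 := fun y => by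
    simp only [softmax]
    rw [← Finset.sum_div, div_self (hpos y).ne']
  refine ⟨fun j y => softmax (f y) j, b, τ, hτ, fun j => ⟨n, f, j, hf, .inr (.inr rfl)⟩, hwpos,
    hwsum, fun y hy t ht => ?_⟩
  refine hlogit _ (abs_le.1 (hB _ ⟨(y, t), ⟨hy, ht⟩, rfl⟩)) _
    (sum_mul_sigmoid_mem_Ioo (fun j => hwpos j y) (hwsum y) _) ?_
  have h1 : |∑ j, softmax (f y) j * Real.sigmoid ((t - b j) / τ) -
      ∑ j, W j y * Real.sigmoid ((t - b j) / τ)| ≤ η / 4 := by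
    rw [← Finset.sum_sub_distrib]
    calc _ ≤ ∑ j, |softmax (f y) j * Real.sigmoid ((t - b j) / τ) -
          W j y * Real.sigmoid ((t - b j) / τ)| := Finset.abs_sum_le_sum_abs _ _
      _ ≤ ∑ j, η / 4 * W j y := by
        refine Finset.sum_le_sum fun j _ => ?_
        rw [← sub_mul, abs_mul, abs_of_pos (Real.sigmoid_pos _), ← hexp]
        refine (mul_le_of_le_one_right (abs_nonneg _) (Real.sigmoid_le_one _)).trans ?_
        exact abs_softmax_sub_le (fun j => hW j y) (hWs y) (fun j => (hfapp y hy j).le) j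
      _ = η / 4 := by rw [← Finset.mul_sum, hWs, mul_one]
  have h2 := hWv y hy t ht
  rw [abs_le] at h1 h2
  rw [abs_lt]
  constructor <;> linarith

theorem exists_mem_DSF_approx {φ : ℝ → ℝ} (hφ : Continuous φ)
    (hpoly : ¬ ∃ p : Polynomial ℝ, ∀ x, φ x = p.eval x) {d : ℕ}
    {u : (k : Fin d) → (Fin k → ℝ) → ℝ → ℝ}
    (hu : ∀ k : Fin d, Continuous fun p : (Fin k → ℝ) × ℝ => u k p.1 p.2)
    (hmono : ∀ k y, StrictMono (u k y)) {K : Set (E d)} (hK : IsCompact K) {ε : ℝ}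
    (hε : 0 < ε) : ∃ g ∈ DSF φ d, ∀ x ∈ K, ∀ k, |g x k - u k (before k x) (x k)| < ε := by
  obtain ⟨M, hM⟩ := hK.isBounded.exists_norm_le
  choose n₀ hn₀ using fun k : Fin d => exists_flow_coordinate_approx hφ hpoly (hu k)
    (hmono k)
    (hK.image (continuous_before k)) M hε
  have hle : ∀ k, n₀ k ≤ ∑ k, n₀ k := fun k =>
    Finset.single_le_sum (fun _ _ => Nat.zero_le _) (Finset.mem_univ k)
  choose w b τ hτ hnn hw hs happ using fun k => hn₀ k (∑ k, n₀ k) (hle k)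
  have hbB : ∀ k j, |b k j| ≤ ∑ k, ∑ j, |b k j| := fun k j =>
    (Finset.single_le_sum (f := fun j => |b k j|) (fun _ _ => abs_nonneg _)
      (Finset.mem_univ j)).trans
    (Finset.single_le_sum (f := fun k => ∑ j, |b k j|)
      (fun _ _ => Finset.sum_nonneg fun _ _ => abs_nonneg _) (Finset.mem_univ k))
  have hτT : ∀ k, τ k ≤ ∑ k, τ k := fun k =>
    Finset.single_le_sum (fun k _ => (hτ k).le) (Finset.mem_univ k)
  have hT : 0 ≤ ∑ k, τ k := Finset.sum_nonneg fun k _ => (hτ k).le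
  refine ⟨fun x => WithLp.toLp 2 fun k => logit (∑ j, w k j (before k x) *
      Real.sigmoid ((x k - b k j) / τ k)),
    ⟨∑ k, n₀ k, w, fun k j _ => b k j, fun k _ _ => τ k, -(∑ k, ∑ j, |b k j|) - 1,
      (∑ k, ∑ j, |b k j|) + 1, (∑ k, τ k) + 1, by linarith, fun k j =>
        ⟨hnn k j, isNeuralNetwork_const _ _ _, isNeuralNetwork_const _ _ _⟩, fun k j y => ?_,
      hs, fun _ _ => rfl⟩, fun x hx k => ?_⟩
  · have h1 := abs_le.1 (hbB k j)
    exact ⟨⟨by linarith, by linarith⟩, ⟨hτ k, by linarith [hτT k]⟩, hw k j y⟩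
  · exact happ k _ ⟨x, hx, rfl⟩ _ (abs_le.1 ((PiLp.norm_apply_le x k).trans (hM x hx)))

/-! ### Steering one parametrized family of points to another -/

/-- On `S`, the map `B` is a uniform limit of maps `g ∘ A` with `g ∈ M`. -/
def SteersTo {d : ℕ} {α : Type*} (M : Set (E d → E d)) (S : Set α) (A B : α → E d) : Prop :=
  ∀ ε > 0, ∃ g ∈ M, ∀ x ∈ S, ‖g (A x) - B x‖ < ε

theorem norm_le_sum_abs {d : ℕ} (v : E d) : ‖v‖ ≤ ∑ i, |v i| := by
  conv_lhs => rw [← (EuclideanSpace.basisFun (Fin d) ℝ).sum_repr v]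
  refine (norm_sum_le _ _).trans (Finset.sum_le_sum fun i _ => ?_)
  simp [norm_smul]

theorem norm_lt_of_coord_lt {d : ℕ} {v : E d} {ε : ℝ} (hε : 0 < ε)
    (h : ∀ i, |v i| < ε / (d + 1)) : ‖v‖ < ε := by
  calc ‖v‖ ≤ ∑ i, |v i| := norm_le_sum_abs v
    _ ≤ ∑ _i : Fin d, ε / (d + 1) := Finset.sum_le_sum fun i _ => (h i).le
    _ = d * (ε / (d + 1)) := by simp
    _ < ε := by
      rw [← mul_div_assoc, div_lt_iff₀ (by positivity)]
      nlinarith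

section Steer

variable {d : ℕ} {α : Type*} {S : Set α} {A B C : α → E d}

theorem SteersTo.congr_right {M : Set (E d → E d)} (h : SteersTo M S A B)
    (hBC : ∀ x ∈ S, B x = C x) : SteersTo M S A C := by
  intro ε hε
  obtain ⟨g, hg, hgx⟩ := h ε hε
  exact ⟨g, hg, fun x hx => hBC x hx ▸ hgx x hx⟩

theorem SteersTo.trans {M : Set (E d → E d)} (hcont : ∀ g ∈ M, Continuous g)
    (hcomp : ∀ f ∈ M, ∀ g ∈ M, f ∘ g ∈ M) (hAB : SteersTo M S A B) (hBC : SteersTo M S B C)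
    (hB : Bornology.IsBounded (B '' S)) : SteersTo M S A C := by
  intro ε hε
  obtain ⟨R, hR⟩ := hB.exists_norm_le
  obtain ⟨g, hg, hgx⟩ := hBC (ε / 2) (half_pos hε)
  have huc := (isCompact_closedBall (0 : E d) (R + 1)).uniformContinuousOn_of_continuous
    (hcont g hg).continuousOn
  rw [Metric.uniformContinuousOn_iff] at huc
  obtain ⟨δ, hδ, hgδ⟩ := huc (ε / 2) (half_pos hε)
  -- The bound `1` keeps `h (A x)` in the ball of radius `R + 1` on which `g` is uniformly
  -- continuous.
  obtain ⟨h, hh, hhx⟩ := hAB (min δ 1) (lt_min hδ one_pos)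
  refine ⟨g ∘ h, hcomp g hg h hh, fun x hx => ?_⟩
  have h1 := hR _ ⟨x, hx, rfl⟩
  have h2 := hhx x hx
  have h3 : ‖h (A x)‖ ≤ R + 1 := by
    have := norm_sub_norm_le (h (A x)) (B x)
    linarith [h2.trans_le (min_le_right δ 1)]
  have h4 := hgδ (h (A x)) (by simpa using h3) (B x) (by simp; linarith)
    (by rw [dist_eq_norm]; exact h2.trans_le (min_le_left _ _))
  rw [dist_eq_norm] at h4
  calc ‖(g ∘ h) (A x) - C x‖ ≤ ‖g (h (A x)) - g (B x)‖ + ‖g (B x) - C x‖ :=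
        norm_sub_le_norm_sub_add_norm_sub _ _ _
    _ < ε := by linarith [hgx x hx]

theorem SteersTo.aff_comp {G : Set (E d → E d)} (hAB : SteersTo (INN G) S A B) {W : E d → E d}
    (hW : W ∈ Aff d) : SteersTo (INN G) S A (W ∘ B) := by
  intro ε hε
  obtain ⟨L, b, rfl⟩ := hW
  let L' : E d →L[ℝ] E d := L.toContinuousLinearEquiv
  obtain ⟨g, hg, hgx⟩ := hAB (ε / (‖L'‖ + 1)) (by positivity)
  refine ⟨_, INN.aff_comp_mem ⟨L, b, rfl⟩ hg, fun x hx => ?_⟩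
  have h1 : ((fun x => L x + b) ∘ g) (A x) - ((fun x => L x + b) ∘ B) x =
      L' (g (A x) - B x) := by
    simp [L']
  rw [h1]
  calc _ ≤ ‖L'‖ * ‖g (A x) - B x‖ := L'.le_opNorm _
    _ ≤ (‖L'‖ + 1) * ‖g (A x) - B x‖ := by
      gcongr; linarith
    _ < (‖L'‖ + 1) * (ε / (‖L'‖ + 1)) := by
      gcongr; exact hgx x hx
    _ = ε := by field_simp

theorem isBounded_image_aff {W : E d → E d} (hW : W ∈ Aff d)
    (hB : Bornology.IsBounded (B '' S)) : Bornology.IsBounded ((W ∘ B) '' S) := by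
  rw [Set.image_comp]
  exact ((hB.isCompact_closure).image (continuous_of_mem_Aff hW)).isBounded.subset
    (Set.image_mono subset_closure)

theorem SteersTo.trans_DSF {φ : ℝ → ℝ} (hφ : Continuous φ)
    (hAB : SteersTo (INN (DSF φ d)) S A B) (hBC : SteersTo (INN (DSF φ d)) S B C) (hB : Bornology.IsBounded (B '' S)) :
    SteersTo (INN (DSF φ d)) S A C :=
  hAB.trans (fun _ hg => INN.continuous (fun _ h => continuous_of_mem_DSF hφ h) hg)
    (fun _ hf _ hg => INN.comp_mem hf hg) hBC hB

end Steer

/-! ### Steering by changes of one coordinate -/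

section Coordinate

variable {d : ℕ} {α : Type*} {S : Set α} {A B : α → E d} {φ : ℝ → ℝ}

/-- The point whose coordinates before the `k`-th are `y`, and whose other coordinates are `t`. -/
noncomputable def extendBefore (k : Fin d) (y : Fin k → ℝ) (t : ℝ) : E d :=
  WithLp.toLp 2 fun i => if h : (i : ℕ) < k then y ⟨i, h⟩ else t

theorem continuous_extendBefore (k : Fin d) :
    Continuous fun p : (Fin k → ℝ) × ℝ => extendBefore k p.1 p.2 := by
  refine (PiLp.continuous_toLp 2 _).comp (continuous_pi fun i => ?_)
  split_ifs <;> fun_prop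

theorem extendBefore_before {k : Fin d} (hk : (k : ℕ) + 1 = d) (x : E d) :
    extendBefore k (before k x) (x k) = x := by
  ext i
  by_cases h : (i : ℕ) < k
  · have h' : i < k := h
    simp [extendBefore, before, h']
  · have : i = k := Fin.ext (by have := i.2; omega)
    simp [extendBefore, this]

/-- Only the last component of a triangular map sees all the variables. The other components are
taken to be the identity. -/
theorem SteersTo.last_coordinate (hφ : Continuous φ)
    (hpoly : ¬ ∃ p : Polynomial ℝ, ∀ x, φ x = p.eval x) (hA : Bornology.IsBounded (A '' S))
    {k : Fin d} (hk : (k : ℕ) + 1 = d) {u : E d → ℝ} (hu : Continuous u)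
    (hmono : ∀ x y : E d, (∀ i ≠ k, x i = y i) → x k < y k → u x < u y)
    (hB : ∀ x ∈ S, ∀ i, B x i = if i = k then u (A x) else A x i) :
    SteersTo (INN (DSF φ d)) S A B := by
  intro ε hε
  obtain ⟨g, hg, hgx⟩ := exists_mem_DSF_approx hφ hpoly
    (u := fun j y t => if j = k then u (extendBefore j y t) else t)
    (fun j => by
      by_cases h : j = k
      · subst h
        simp only [if_true]
        exact hu.comp (continuous_extendBefore j)
      · simpa only [h, if_false] using continuous_snd)
    (fun j y t t' htt => by
      by_cases h : j = k
      · subst h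
        simp only [if_true]
        refine hmono _ _ (fun i hi => ?_) (by simpa [extendBefore] using htt)
        have : i < j := by
          rw [Fin.lt_def]
          have h1 := i.2
          have h2 : (i : ℕ) ≠ j := fun h => hi (Fin.ext h)
          omega
        simp [extendBefore, this]
      · simpa only [h, if_false] using htt)
    hA.isCompact_closure (show 0 < ε / (d + 1) by positivity)
  refine ⟨g, INN.mem_of_mem hg, fun x hx => norm_lt_of_coord_lt hε fun i => ?_⟩
  have h1 := hgx (A x) (subset_closure ⟨x, hx, rfl⟩) i
  rw [PiLp.sub_apply, hB x hx i]
  by_cases h : i = k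
  · subst h
    simpa only [if_true, extendBefore_before hk] using h1
  · simpa only [h, if_false] using h1

/-- Every network applies a flow first, so even the identity is reached only as a limit. This is
what lets an affine map act at the start. -/
theorem SteersTo.refl (hφ : Continuous φ) (hpoly : ¬ ∃ p : Polynomial ℝ, ∀ x, φ x = p.eval x)
    (hA : Bornology.IsBounded (A '' S)) : SteersTo (INN (DSF φ d)) S A A := by
  intro ε hε
  obtain ⟨g, hg, hgx⟩ := exists_mem_DSF_approx (d := d) hφ hpoly (u := fun _ _ t => t)
    (fun _ => continuous_snd) (fun _ _ => strictMono_id)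
    hA.isCompact_closure (show 0 < ε / (d + 1) by positivity)
  exact ⟨g, INN.mem_of_mem hg, fun x hx => norm_lt_of_coord_lt hε fun i =>
    hgx (A x) (subset_closure ⟨x, hx, rfl⟩) i⟩

theorem SteersTo.coordinate (hφ : Continuous φ)
    (hpoly : ¬ ∃ p : Polynomial ℝ, ∀ x, φ x = p.eval x) (hA : Bornology.IsBounded (A '' S))
    {k : Fin d} {u : E d → ℝ} (hu : Continuous u)
    (hmono : ∀ x y : E d, (∀ i ≠ k, x i = y i) → x k < y k → u x < u y)
    (hB : ∀ x ∈ S, ∀ i, B x i = if i = k then u (A x) else A x i) :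
    SteersTo (INN (DSF φ d)) S A B := by
  have hd : 0 < d := k.pos
  let l : Fin d := ⟨d - 1, by omega⟩
  -- Conjugating by the swap of `k` with the last index reduces to `SteersTo.last_coordinate`.
  let P : E d ≃ₗᵢ[ℝ] E d := LinearIsometryEquiv.piLpCongrLeft 2 ℝ ℝ (Equiv.swap k l)
  have hP : ∀ x i, P x i = x (Equiv.swap k l i) := fun x i => by
    simp [P, LinearIsometryEquiv.piLpCongrLeft_apply, Equiv.piCongrLeft'_apply]
  have hPP : ∀ x, P (P x) = x := fun x => by ext i; simp [hP]
  have hPA : (P : E d → E d) ∈ Aff d := ⟨P.toLinearEquiv, 0, by ext1 x; simp⟩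
  have h1 : SteersTo (INN (DSF φ d)) S A (P ∘ A) := (SteersTo.refl hφ hpoly hA).aff_comp hPA
  have h2 : SteersTo (INN (DSF φ d)) S (P ∘ A) (P ∘ B) := by
    refine SteersTo.last_coordinate (k := l) hφ hpoly (isBounded_image_aff hPA hA)
      (by simp only [l]; omega) (u := u ∘ P) (hu.comp P.continuous) (fun x y hxy hlt => ?_)
      (fun x hx i => ?_)
    · refine hmono _ _ (fun i hi => ?_) (by simpa [hP] using hlt)
      rw [hP, hP]
      refine hxy _ fun h => hi ?_
      rw [Equiv.swap_apply_eq_iff] at h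
      simpa using h
    · simp only [Function.comp_apply, hP, hPP, hB x hx, Equiv.swap_apply_eq_iff,
        Equiv.swap_apply_left]
  have h3 : SteersTo (INN (DSF φ d)) S (P ∘ A) (P ∘ (P ∘ B)) := h2.aff_comp hPA
  exact (h1.trans_DSF hφ h3 (isBounded_image_aff hPA hA)).congr_right fun x _ => hPP _

end Coordinate

/-! ### Steering by maps close to the identity -/

section Near

variable {d : ℕ} {α : Type*} {S : Set α} {A B : α → E d} {φ : ℝ → ℝ}

/-- The point whose first `k` coordinates are those of `y` and whose others are those of `x`. -/
noncomputable def splice (k : ℕ) (x y : E d) : E d :=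
  WithLp.toLp 2 fun i => if (i : ℕ) < k then y i else x i

theorem norm_splice_le (k : ℕ) (x y : E d) : ‖splice k x y‖ ≤ ‖x‖ + ‖y‖ := by
  have h : ∀ v w : E d, (∀ i, |v i| ≤ |w i|) → ‖v‖ ≤ ‖w‖ := fun v w hvw => by
    rw [EuclideanSpace.norm_eq, EuclideanSpace.norm_eq]
    refine Real.sqrt_le_sqrt (Finset.sum_le_sum fun i _ => ?_)
    gcongr
    exact hvw i
  have hs : splice k x y = splice k x 0 + splice k 0 y := by
    ext i; by_cases hi : (i : ℕ) < k <;> simp [splice, hi]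
  rw [hs]
  refine (norm_add_le _ _).trans (add_le_add (h _ _ fun i => ?_) (h _ _ fun i => ?_))
  · by_cases hi : (i : ℕ) < k <;> simp [splice, hi]
  · by_cases hi : (i : ℕ) < k <;> simp [splice, hi]

theorem isBounded_splice (k : ℕ) (hA : Bornology.IsBounded (A '' S))
    (hB : Bornology.IsBounded (B '' S)) :
    Bornology.IsBounded ((fun x => splice k (A x) (B x)) '' S) := by
  obtain ⟨a, ha⟩ := hA.exists_norm_le
  obtain ⟨b, hb⟩ := hB.exists_norm_le
  refine isBounded_iff_forall_norm_le.2 ⟨a + b, ?_⟩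
  rintro _ ⟨x, hx, rfl⟩
  exact (norm_splice_le _ _ _).trans (add_le_add (ha _ ⟨x, hx, rfl⟩) (hb _ ⟨x, hx, rfl⟩))

theorem norm_le_norm_splice_sub {k : ℕ} {a b a' b' : E d}
    (h : ‖(b - a) - (b' - a')‖ ≤ 1 / 3 * ‖a - a'‖) :
    2 / 3 * ‖a - a'‖ ≤ ‖splice k a b - splice k a' b'‖ := by
  have hs : splice k a b - splice k a' b' = (a - a') + splice k 0 ((b - a) - (b' - a')) := by
    ext i; by_cases hi : (i : ℕ) < k <;> simp [splice, hi]; ring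
  have h1 := norm_splice_le k 0 ((b - a) - (b' - a'))
  rw [norm_zero, zero_add] at h1
  have h2 := norm_sub_le_norm_add (a - a') (splice k 0 ((b - a) - (b' - a')))
  rw [hs]
  linarith

/-- Coordinates of `A` are replaced by those of `B` one at a time. Each hybrid still separates
points by `2/3` of what `A` does, so the next correction `B_k - A_k` is a function of the current
position with Lipschitz constant `(1/3) / (2/3) = 1/2`. -/
theorem SteersTo.of_close (hφ : Continuous φ)
    (hpoly : ¬ ∃ p : Polynomial ℝ, ∀ x, φ x = p.eval x) (hA : Bornology.IsBounded (A '' S))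
    (hB : Bornology.IsBounded (B '' S))
    (hAB : ∀ x ∈ S, ∀ y ∈ S, ‖(B x - A x) - (B y - A y)‖ ≤ 1 / 3 * ‖A x - A y‖) :
    SteersTo (INN (DSF φ d)) S A B := by
  have key : ∀ k ≤ d, SteersTo (INN (DSF φ d)) S A fun x => splice k (A x) (B x) := by
    intro k
    induction k with
    | zero =>
      intro _
      exact (SteersTo.refl hφ hpoly hA).congr_right fun x _ => by ext i; simp [splice]
    | succ k ih =>
      intro hk
      refine (ih (by omega)).trans_DSF hφ ?_ (isBounded_splice k hA hB)
      let k' : Fin d := ⟨k, hk⟩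
      let F : α → E d := fun x => splice k (A x) (B x)
      let D : α → ℝ := fun x => B x k' - A x k'
      have hD : ∀ x ∈ S, ∀ y ∈ S, |D x - D y| ≤ 1 / 2 * ‖F x - F y‖ := fun x hx y hy => by
        have h1 := norm_le_norm_splice_sub (k := k) (hAB x hx y hy)
        have h2 : |D x - D y| ≤ ‖(B x - A x) - (B y - A y)‖ :=
          PiLp.norm_apply_le ((B x - A x) - (B y - A y)) k'
        have h3 := hAB x hx y hy
        change 2 / 3 * _ ≤ ‖F x - F y‖ at h1
        linarith
      obtain hS | ⟨x₀, -⟩ := S.eq_empty_or_nonempty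
      · intro ε _
        obtain ⟨g, hg, -⟩ := SteersTo.refl hφ hpoly hA 1 one_pos
        exact ⟨g, hg, by simp [hS]⟩
      have : Nonempty α := ⟨x₀⟩
      have hinv : ∀ x ∈ S, Function.invFunOn F S (F x) ∈ S ∧
          F (Function.invFunOn F S (F x)) = F x := fun x hx =>
        ⟨Function.invFunOn_mem ⟨x, hx, rfl⟩, Function.invFunOn_eq ⟨x, hx, rfl⟩⟩
      have hlip : LipschitzOnWith (1 / 2) (D ∘ Function.invFunOn F S) (F '' S) := by
        refine LipschitzOnWith.of_dist_le_mul ?_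
        rintro _ ⟨x, hx, rfl⟩ _ ⟨y, hy, rfl⟩
        have := hD _ (hinv x hx).1 _ (hinv y hy).1
        rw [(hinv x hx).2, (hinv y hy).2] at this
        simpa [Real.dist_eq, dist_eq_norm] using this
      -- The extension to all of `ℝ^d` keeps the constant `1/2 < 1`, so `z k' + w z` is strictly
      -- increasing in the `k'`-th coordinate.
      obtain ⟨w, hw, hwe⟩ := hlip.extend_real
      have hwD : ∀ x ∈ S, w (F x) = D x := fun x hx => by
        rw [← hwe ⟨x, hx, rfl⟩]
        have := hD _ (hinv x hx).1 x hx
        rw [(hinv x hx).2, sub_self, norm_zero, mul_zero] at this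
        exact sub_eq_zero.1 (abs_nonpos_iff.1 this)
      refine SteersTo.coordinate (k := k') hφ hpoly (isBounded_splice k hA hB)
        (u := fun z => z k' + w z)
        ((by fun_prop : Continuous fun z : E d => z k').add hw.continuous)
        (fun x y hxy hlt => ?_) (fun x hx i => ?_)
      · have h1 := hw.dist_le_mul y x
        have h2 : y - x = EuclideanSpace.single k' (y k' - x k') := by
          ext i
          by_cases hi : i = k'
          · simp [hi]
          · simp [hi, hxy i hi]
        rw [dist_eq_norm y x, h2, PiLp.norm_single, Real.norm_eq_abs,
          abs_of_pos (sub_pos.2 hlt), Real.dist_eq] at h1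
        have h3 := (abs_le.1 h1).1
        simp only [NNReal.coe_div, NNReal.coe_one, NNReal.coe_ofNat] at h3
        linarith
      · have hF : splice k (A x) (B x) = F x := rfl
        rw [hF, hwD x hx]
        by_cases hi : i = k'
        · subst hi
          simp [splice, F, D, k']
        · have h1 : (i : ℕ) ≠ k := fun h => hi (Fin.ext h)
          have h2 : (i : ℕ) ≤ k ↔ (i : ℕ) < k := by omega
          simp [splice, F, hi, h2]
  exact (key d le_rfl).congr_right fun x _ => by ext i; simp [splice]

end Near

/-! ### The isotopy from an embedding to its linearization -/

section Isotopy

open Filter Topology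

variable {d : ℕ} {φ : ℝ → ℝ} {F : E d → E d} {R c : ℝ}

/-- The isotopy `x ↦ (F (t x) - F 0) / t`, extended to `t = 0` by the derivative of `F` at `0`. -/
noncomputable def rescale (F : E d → E d) (t : ℝ) (x : E d) : E d :=
  if t = 0 then fderiv ℝ F 0 x else t⁻¹ • (F (t • x) - F 0)

theorem hasFDerivAt_rescale (hF : ContDiff ℝ 1 F) (t : ℝ) (x : E d) :
    HasFDerivAt (rescale F t) (fderiv ℝ F (t • x)) x := by
  by_cases ht : t = 0
  · have : rescale F t = fderiv ℝ F 0 := by ext1 y; simp [rescale, ht]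
    rw [this, ht, zero_smul]
    exact (fderiv ℝ F 0).hasFDerivAt
  · have h1 : HasFDerivAt (fun y : E d => t • y) (t • ContinuousLinearMap.id ℝ (E d)) x :=
      (hasFDerivAt_id x).const_smul t
    have h2 := ((((hF.differentiable one_ne_zero) (t • x)).hasFDerivAt.comp x h1).sub_const
      (F 0)).const_smul t⁻¹
    have h3 : rescale F t = fun y => t⁻¹ • ((F ∘ fun y => t • y) y - F 0) := by
      ext1 y; simp [rescale, ht]
    rw [h3]
    refine h2.congr_fderiv ?_
    ext1 v
    simp [smul_smul, ht]

theorem continuous_rescale (hF : ContDiff ℝ 1 F) (t : ℝ) : Continuous (rescale F t) :=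
  continuous_iff_continuousAt.2 fun x => (hasFDerivAt_rescale hF t x).continuousAt

theorem smul_mem_closedBall_zero {t : ℝ} (ht : t ∈ Set.Icc (0 : ℝ) 1) {x : E d}
    (hx : x ∈ Metric.closedBall 0 R) : t • x ∈ Metric.closedBall (0 : E d) R := by
  rw [mem_closedBall_zero_iff] at hx ⊢
  rw [norm_smul, Real.norm_eq_abs, abs_of_nonneg ht.1]
  exact (mul_le_of_le_one_left (norm_nonneg _) ht.2).trans hx

/-- The lower bound is invariant under rescaling for `t > 0`, and passes to the limit at `t = 0`. -/
theorem le_norm_rescale_sub (hF : ContDiff ℝ 1 F)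
    (hc : ∀ x ∈ Metric.closedBall (0 : E d) R, ∀ y ∈ Metric.closedBall (0 : E d) R,
      c * ‖x - y‖ ≤ ‖F x - F y‖) {t : ℝ} (ht : t ∈ Set.Icc (0 : ℝ) 1) {x y : E d}
    (hx : x ∈ Metric.closedBall 0 R) (hy : y ∈ Metric.closedBall 0 R) :
    c * ‖x - y‖ ≤ ‖rescale F t x - rescale F t y‖ := by
  have hpos : ∀ s ∈ Set.Ioc (0 : ℝ) 1,
      c * ‖x - y‖ ≤ ‖s⁻¹ • (F (s • x) - F 0) - s⁻¹ • (F (s • y) - F 0)‖ := fun s hs => by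
    have hs' : s ∈ Set.Icc (0 : ℝ) 1 := ⟨hs.1.le, hs.2⟩
    have h1 := hc _ (smul_mem_closedBall_zero hs' hx) _ (smul_mem_closedBall_zero hs' hy)
    rw [← smul_sub, norm_smul, Real.norm_eq_abs, abs_of_pos hs.1] at h1
    rw [← smul_sub, sub_sub_sub_cancel_right, norm_smul, Real.norm_eq_abs,
      abs_of_pos (inv_pos.2 hs.1), ← div_eq_inv_mul, le_div_iff₀ hs.1]
    linarith
  by_cases h0 : t = 0
  · have hlim : ∀ z, Tendsto (fun r : ℝ => (r⁻¹)⁻¹ • (F (r⁻¹ • z) - F 0)) atTop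
        (𝓝 (fderiv ℝ F 0 z)) := fun z => by
      simpa using ((hF.differentiable one_ne_zero) 0).hasFDerivAt.lim_real z
    simp only [rescale, h0, if_true]
    refine ge_of_tendsto ((hlim x).sub (hlim y)).norm ?_
    filter_upwards [eventually_ge_atTop (1 : ℝ)] with r hr
    exact hpos r⁻¹ ⟨by positivity, inv_le_one_of_one_le₀ hr⟩
  · simp only [rescale, h0, if_false]
    exact hpos t ⟨lt_of_le_of_ne ht.1 (Ne.symm h0), ht.2⟩

/-- The derivative of the difference is `DF(s z) - DF(t z)`, uniformly small on the ball, and the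
mean value inequality concludes. Including `t = 0` needs only `F` of class `C¹`. -/
theorem exists_rescale_close (hF : ContDiff ℝ 1 F) (hR : 0 < R) {e : ℝ} (he : 0 < e) :
    ∃ δ > 0, ∀ t ∈ Set.Icc (0 : ℝ) 1, ∀ s ∈ Set.Icc (0 : ℝ) 1, |t - s| < δ →
      ∀ x ∈ Metric.closedBall (0 : E d) R, ∀ y ∈ Metric.closedBall (0 : E d) R,
      ‖(rescale F s x - rescale F t x) - (rescale F s y - rescale F t y)‖ ≤ e * ‖x - y‖ := by
  have huc := (isCompact_closedBall (0 : E d) R).uniformContinuousOn_of_continuous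
    (hF.continuous_fderiv one_ne_zero).continuousOn
  rw [Metric.uniformContinuousOn_iff] at huc
  obtain ⟨δ, hδ, h⟩ := huc e he
  refine ⟨δ / R, by positivity, fun t ht s hs hts x hx y hy => ?_⟩
  refine (convex_closedBall (0 : E d) R).norm_image_sub_le_of_norm_hasFDerivWithin_le
    (𝕜 := ℝ) (f := fun x => rescale F s x - rescale F t x)
    (fun z _ => ((hasFDerivAt_rescale hF s z).sub
      (hasFDerivAt_rescale hF t z)).hasFDerivWithinAt) (fun z hz => ?_) hy hx
  have h1 := h _ (smul_mem_closedBall_zero hs hz) _ (smul_mem_closedBall_zero ht hz) (by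
    rw [dist_eq_norm, ← sub_smul, norm_smul, Real.norm_eq_abs, abs_sub_comm]
    rw [lt_div_iff₀ hR] at hts
    refine lt_of_le_of_lt ?_ hts
    exact mul_le_mul_of_nonneg_left (mem_closedBall_zero_iff.1 hz) (abs_nonneg _))
  rw [dist_eq_norm] at h1
  exact h1.le

theorem steersTo_rescale (hφ : Continuous φ)
    (hpoly : ¬ ∃ p : Polynomial ℝ, ∀ x, φ x = p.eval x) (hF : ContDiff ℝ 1 F) (hR : 0 < R)
    (hc0 : 0 < c)
    (hc : ∀ x ∈ Metric.closedBall (0 : E d) R, ∀ y ∈ Metric.closedBall (0 : E d) R,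
      c * ‖x - y‖ ≤ ‖F x - F y‖) :
    SteersTo (INN (DSF φ d)) (Metric.closedBall (0 : E d) R) (rescale F 0) (rescale F 1) ∧
      SteersTo (INN (DSF φ d)) (Metric.closedBall (0 : E d) R) (rescale F 1) (rescale F 0) := by
  have hb : ∀ t, Bornology.IsBounded (rescale F t '' Metric.closedBall (0 : E d) R) := fun t =>
    ((isCompact_closedBall _ _).image (continuous_rescale hF t)).isBounded
  -- `c / 3` against the lower bound `c` yields the relative constant `1 / 3` of
  -- `SteersTo.of_close`.
  obtain ⟨δ, hδ, hclose⟩ := exists_rescale_close hF hR (show 0 < c / 3 by positivity)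
  have hstep : ∀ t ∈ Set.Icc (0 : ℝ) 1, ∀ s ∈ Set.Icc (0 : ℝ) 1, |t - s| < δ →
      SteersTo (INN (DSF φ d)) (Metric.closedBall (0 : E d) R) (rescale F t) (rescale F s) :=
    fun t ht s hs hts => SteersTo.of_close hφ hpoly (hb t) (hb s) fun x hx y hy => by
      linarith [hclose t ht s hs hts x hx y hy, le_norm_rescale_sub hF hc ht hx hy]
  obtain ⟨N, hN⟩ := exists_nat_one_div_lt hδ
  have hNpos : (0 : ℝ) < N + 1 := by positivity
  have hmem : ∀ i ≤ N + 1, (i : ℝ) / (N + 1) ∈ Set.Icc (0 : ℝ) 1 := fun i hi =>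
    ⟨by positivity, (div_le_one hNpos).2 (by exact_mod_cast hi)⟩
  have hdist : ∀ i : ℕ, ((i + 1 : ℕ) : ℝ) / (N + 1) - (i : ℝ) / (N + 1) = 1 / (N + 1) :=
    fun i => by push_cast; ring
  have hdiv : (0 : ℝ) < 1 / (N + 1) := by positivity
  have key : ∀ i ≤ N + 1,
      SteersTo (INN (DSF φ d)) (Metric.closedBall (0 : E d) R) (rescale F 0)
        (rescale F (i / (N + 1))) ∧
      SteersTo (INN (DSF φ d)) (Metric.closedBall (0 : E d) R) (rescale F (i / (N + 1)))
        (rescale F 0) := by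
    intro i
    induction i with
    | zero =>
      intro _
      simpa using SteersTo.refl hφ hpoly (hb 0)
    | succ i ih =>
      intro hi
      obtain ⟨h1, h2⟩ := ih (by omega)
      have m1 := hmem i (by omega)
      have m2 := hmem (i + 1) hi
      refine ⟨h1.trans_DSF hφ (hstep _ m1 _ m2 ?_) (hb _),
        (hstep _ m2 _ m1 ?_).trans_DSF hφ h2 (hb _)⟩
      · rw [abs_sub_comm, hdist, abs_of_pos hdiv]; exact hN
      · rw [hdist, abs_of_pos hdiv]; exact hN
  have := key (N + 1) le_rfl
  rwa [Nat.cast_add, Nat.cast_one, div_self hNpos.ne'] at this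

theorem translate_mem_Aff (b : E d) : (fun x => x + b) ∈ Aff d :=
  ⟨.refl ℝ _, b, by ext1 x; simp⟩

theorem steersTo_fderiv (hφ : Continuous φ)
    (hpoly : ¬ ∃ p : Polynomial ℝ, ∀ x, φ x = p.eval x) (hF : ContDiff ℝ 1 F) (hR : 0 < R)
    (hc0 : 0 < c)
    (hc : ∀ x ∈ Metric.closedBall (0 : E d) R, ∀ y ∈ Metric.closedBall (0 : E d) R,
      c * ‖x - y‖ ≤ ‖F x - F y‖) :
    SteersTo (INN (DSF φ d)) (Metric.closedBall (0 : E d) R) (fderiv ℝ F 0) F ∧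
      SteersTo (INN (DSF φ d)) (Metric.closedBall (0 : E d) R) F (fderiv ℝ F 0) := by
  obtain ⟨h1, h2⟩ := steersTo_rescale hφ hpoly hF hR hc0 hc
  have e0 : rescale F 0 = fderiv ℝ F 0 := by ext1 x; simp [rescale]
  have e1 : rescale F 1 = fun x => F x + -F 0 := by ext1 x; simp [rescale, sub_eq_add_neg]
  rw [e0, e1] at h1 h2
  have hb : Bornology.IsBounded (F '' Metric.closedBall (0 : E d) R) :=
    ((isCompact_closedBall _ _).image hF.continuous).isBounded
  refine ⟨(h1.aff_comp (translate_mem_Aff (F 0))).congr_right fun x _ => by simp, ?_⟩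
  exact ((SteersTo.refl hφ hpoly hb).aff_comp (translate_mem_Aff (-F 0))).trans_DSF hφ h2
    (isBounded_image_aff (translate_mem_Aff (-F 0)) hb)

theorem exists_linearEquiv_fderiv (hF : ContDiff ℝ 1 F) (hR : 0 < R) (hc0 : 0 < c)
    (hc : ∀ x ∈ Metric.closedBall (0 : E d) R, ∀ y ∈ Metric.closedBall (0 : E d) R,
      c * ‖x - y‖ ≤ ‖F x - F y‖) : ∃ L : E d ≃ₗ[ℝ] E d, ∀ x, L x = fderiv ℝ F 0 x := by
  have hinj : Function.Injective (fderiv ℝ F 0 : E d →ₗ[ℝ] E d) := by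
    rw [← LinearMap.ker_eq_bot, LinearMap.ker_eq_bot']
    intro x hx
    by_contra hne
    have hn : 0 < ‖x‖ := norm_pos_iff.2 hne
    -- A kernel vector is rescaled into the ball, the only place where the lower bound is known.
    have h1 : ‖(R / ‖x‖) • x‖ = R := by
      rw [norm_smul, Real.norm_eq_abs, abs_of_pos (by positivity), div_mul_cancel₀ _ hn.ne']
    have h2 := le_norm_rescale_sub hF hc (t := 0) ⟨le_rfl, zero_le_one⟩
      (x := (R / ‖x‖) • x) (y := 0) (by rw [mem_closedBall_zero_iff, h1]) (by simp [hR.le])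
    have hx' : fderiv ℝ F 0 x = 0 := hx
    rw [sub_zero, h1] at h2
    simp only [rescale, if_true, map_smul, hx', smul_zero, map_zero, sub_zero, norm_zero] at h2
    nlinarith
  exact ⟨LinearEquiv.ofInjectiveEndo _ hinj, fun x => rfl⟩

/-- Go from `G` to `DG(0)`, then to `DH(0)` by a linear isomorphism, then to `H`. -/
theorem SteersTo.of_embeddings (hφ : Continuous φ)
    (hpoly : ¬ ∃ p : Polynomial ℝ, ∀ x, φ x = p.eval x) {G H : E d → E d}
    (hG : ContDiff ℝ 1 G) (hH : ContDiff ℝ 1 H) (hR : 0 < R) {c' : ℝ} (hc0 : 0 < c)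
    (hc0' : 0 < c')
    (hGc : ∀ x ∈ Metric.closedBall (0 : E d) R, ∀ y ∈ Metric.closedBall (0 : E d) R,
      c * ‖x - y‖ ≤ ‖G x - G y‖)
    (hHc : ∀ x ∈ Metric.closedBall (0 : E d) R, ∀ y ∈ Metric.closedBall (0 : E d) R,
      c' * ‖x - y‖ ≤ ‖H x - H y‖) :
    SteersTo (INN (DSF φ d)) (Metric.closedBall (0 : E d) R) G H := by
  have hb : ∀ L : E d →L[ℝ] E d, Bornology.IsBounded (L '' Metric.closedBall (0 : E d) R) :=
    fun L => ((isCompact_closedBall _ _).image L.continuous).isBounded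
  obtain ⟨-, h1⟩ := steersTo_fderiv hφ hpoly hG hR hc0 hGc
  obtain ⟨h2, -⟩ := steersTo_fderiv hφ hpoly hH hR hc0' hHc
  obtain ⟨L, hL⟩ := exists_linearEquiv_fderiv hG hR hc0 hGc
  obtain ⟨L', hL'⟩ := exists_linearEquiv_fderiv hH hR hc0' hHc
  have h3 := h1.aff_comp (W := fun x => (L.symm.trans L') x + 0) ⟨L.symm.trans L', 0, rfl⟩
  refine (h3.congr_right (C := fderiv ℝ H 0) fun x _ => ?_).trans_DSF hφ h2 (hb _)
  simp [← hL, ← hL']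

/-- The inverse `k` is locally Lipschitz, hence Lipschitz on the compact set `h '' S`. -/
theorem exists_mul_norm_sub_le_of_leftInverse {S V : Set (E d)} (hS : IsCompact S)
    (hV : IsOpen V) {h k : E d → E d} (hh : Continuous h) (hk : ContDiffOn ℝ 1 k V)
    (hSV : ∀ x ∈ S, h x ∈ V) (hkh : ∀ x ∈ S, k (h x) = x) :
    ∃ c > 0, ∀ x ∈ S, ∀ y ∈ S, c * ‖x - y‖ ≤ ‖h x - h y‖ := by
  have hloc : LocallyLipschitzOn (h '' S) k := by
    rintro _ ⟨x, hx, rfl⟩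
    obtain ⟨K, t, ht, hl⟩ :=
      (hk.contDiffAt (hV.mem_nhds (hSV x hx))).exists_lipschitzOnWith
    exact ⟨K, t, mem_nhdsWithin_of_mem_nhds ht, hl⟩
  obtain ⟨K, hK⟩ := hloc.exists_lipschitzOnWith_of_compact (hS.image hh)
  refine ⟨1 / (K + 1), by positivity, fun x hx y hy => ?_⟩
  have h1 := hK.dist_le_mul _ ⟨x, hx, rfl⟩ _ ⟨y, hy, rfl⟩
  rw [hkh x hx, hkh y hy, dist_eq_norm, dist_eq_norm] at h1
  rw [div_mul_eq_mul_div, one_mul, div_le_iff₀ (by positivity)]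
  linarith [norm_nonneg (h x - h y)]

end Isotopy

/-! ### Universality -/

theorem supNorm_lt_of_forall_lt {d : ℕ} {K : Set (E d)} {f : E d → E d} {ε : ℝ} (hε : 0 < ε)
    (h : ∀ x ∈ K, ‖f x‖ < ε / 2) : supNorm K f < ENNReal.ofReal ε := by
  have h1 : supNorm K f ≤ ENNReal.ofReal (ε / 2) :=
    iSup₂_le fun x hx => by
      rw [← ofReal_norm]
      exact ENNReal.ofReal_le_ofReal (h x hx).le
  exact h1.trans_lt ((ENNReal.ofReal_lt_ofReal_iff hε).2 (by linarith))

theorem isSupUniversal_DTwo {φ : ℝ → ℝ} (hφ : Continuous φ)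
    (hpoly : ¬ ∃ p : Polynomial ℝ, ∀ x, φ x = p.eval x) (d : ℕ) :
    IsSupUniversal (INN (DSF φ d)) (DTwo d) := by
  rintro ⟨U, f⟩ ⟨⟨ψ, hU, -, hψ, hψd, g, hg, hgd⟩, V, -, hV, hf, hfd, f', hf', hfd'⟩ ε hε K hK hKU
  simp only at *
  have hgU : ∀ y, g y ∈ U := fun y => by
    obtain ⟨x, hx, rfl⟩ := hψ.surjOn (Set.mem_univ y)
    rw [hg.1 hx]
    exact hx
  have hψg : ∀ y, ψ (g y) = y := fun y => hg.2 (Set.mem_univ y)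
  have hf'U : ∀ y ∈ V, f' y ∈ U := fun y hy => by
    obtain ⟨x, hx, rfl⟩ := hf.surjOn hy
    rw [hf'.1 hx]
    exact hx
  have hgC : ContDiff ℝ 1 g := (contDiffOn_univ.1 hgd).of_le (by norm_num)
  have hfg : ContDiff ℝ 1 (f ∘ g) := by
    rw [← contDiffOn_univ]
    exact (hfd.of_le (by norm_num)).comp hgC.contDiffOn fun y _ => hgU y
  obtain ⟨R, hR, hψR⟩ :=
    (hK.image_of_continuousOn (hψd.continuousOn.mono hKU)).isBounded.exists_pos_norm_le
  have hS := isCompact_closedBall (0 : E d) R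
  obtain ⟨c, hc0, hc⟩ := exists_mul_norm_sub_le_of_leftInverse hS hU hgC.continuous
    (hψd.of_le (by norm_num)) (fun x _ => hgU x) fun x _ => hψg x
  obtain ⟨c', hc0', hc'⟩ := exists_mul_norm_sub_le_of_leftInverse hS hV hfg.continuous
    (k := ψ ∘ f') ((hψd.comp hfd' hf'U).of_le (by norm_num)) (fun x _ => hf.mapsTo (hgU x))
    fun x _ => by simp [hf'.1 (hgU x), hψg]
  -- At the parameter `ψ z` with `z ∈ K`, steering `g` to `f ∘ g` says that `m z` is close to `f z`.
  obtain ⟨m, hm, hmx⟩ := SteersTo.of_embeddings hφ hpoly hgC hfg hR hc0 hc0' hc hc' (ε / 2)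
    (half_pos hε)
  refine ⟨m, hm, supNorm_lt_of_forall_lt hε fun z hz => ?_⟩
  have h1 := hmx (ψ z) (by simpa using hψR _ ⟨z, hz, rfl⟩)
  rw [Function.comp_apply, hg.1 (hKU hz), norm_sub_rev] at h1
  exact h1

/-- A continuous injection of the line is strictly monotone, and two fixed points rule out a
decreasing one. -/
theorem strictMono_of_eq_self_off_compact {h : ℝ → ℝ} (hc : Continuous h)
    (hi : Function.Injective h) {R : ℝ} (hR : ∀ t, R < |t| → h t = t) : StrictMono h := by
  obtain hm | ha := hc.strictMono_of_inj hi
  · exact hm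
  · have h1 : h (|R| + 1) = |R| + 1 := hR _ (by
      rw [abs_of_pos (by positivity)]; linarith [le_abs_self R])
    have h2 : h (|R| + 2) = |R| + 2 := hR _ (by
      rw [abs_of_pos (by positivity)]; linarith [le_abs_self R])
    have := ha (show |R| + 1 < |R| + 2 by linarith)
    rw [h1, h2] at this
    linarith

theorem isSupUniversal_singleCoord {φ : ℝ → ℝ} (hφ : Continuous φ)
    (hpoly : ¬ ∃ p : Polynomial ℝ, ∀ x, φ x = p.eval x) {d : ℕ} (hd : 0 < d) :
    IsSupUniversal (INN (DSF φ d)) (SingleCoord d 1) := by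
  rintro ⟨U, f⟩ ⟨hU, ⟨-, -, hf, hfd, -⟩, hcoord, C, hC, hfC⟩ ε hε K hK -
  simp only at *
  have hfc : Continuous f := by simpa [← contDiffOn_univ] using (contDiffOn_univ.1 hfd).continuous
  have hinj : Function.Injective f := Set.injOn_univ.1 hf.injOn
  let k : Fin d := ⟨d - 1, by omega⟩
  have hk : ∀ i ≠ k, (i : ℕ) + 1 < d := fun i hi => by
    have h1 : (i : ℕ) ≠ d - 1 := fun h => hi (Fin.ext h)
    have := i.2
    omega
  obtain ⟨R, hR⟩ := hC.isBounded.exists_norm_le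
  have hmono : ∀ x y : E d, (∀ i ≠ k, x i = y i) → x k < y k → f x k < f y k := by
    intro x y hxy hlt
    -- The line through `x` in the last direction. As `f` fixes the other coordinates, its
    -- injectivity makes `t ↦ f (p t) k` injective.
    let p : ℝ → E d := fun t => x + EuclideanSpace.single k (t - x k)
    have hpk : ∀ t, p t k = t := fun t => by simp [p]
    have hpi : ∀ t, ∀ i ≠ k, p t i = x i := fun t i hi => by simp [p, hi]
    have hpc : Continuous p := by
      refine (PiLp.continuous_toLp 2 _).comp (continuous_pi fun i => ?_)
      by_cases hi : i = k
      · subst hi; simpa using continuous_id'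
      · simpa [hi] using continuous_const
    have hsm : StrictMono fun t => f (p t) k := by
      refine strictMono_of_eq_self_off_compact (R := R)
        ((by fun_prop : Continuous fun z : E d => z k).comp (hfc.comp hpc)) (fun s t hst => ?_)
        fun t ht => ?_
      · have h1 : f (p s) = f (p t) := by
          ext i
          by_cases hi : i = k
          · rw [hi]; exact hst
          · rw [hcoord _ i (hk i hi), hcoord _ i (hk i hi), hpi s i hi, hpi t i hi]
        rw [← hpk s, hinj h1, hpk]
      · have h1 : p t ∉ C := fun hmem => by
          have h2 := PiLp.norm_apply_le (p t) k
          rw [hpk, Real.norm_eq_abs] at h2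
          linarith [hR _ hmem]
        change f (p t) k = t
        rw [hfC _ h1, hpk]
    have hx : p (x k) = x := by simp [p]
    have hy : p (y k) = y := by
      ext i
      by_cases hi : i = k
      · rw [hi, hpk]
      · rw [hpi _ i hi, hxy i hi]
    have := hsm hlt
    simpa only [hx, hy] using this
  obtain ⟨m, hm, hmx⟩ := SteersTo.last_coordinate (S := K) (A := id) (B := f) hφ hpoly
    (by simpa using hK.isBounded) (k := k) (by simp only [k]; omega) (u := fun x => f x k)
    ((by fun_prop : Continuous fun z : E d => z k).comp hfc) hmono (fun x _ i => by
      by_cases hi : i = k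
      · simp [hi]
      · simp [hi, hcoord x i (hk i hi)]) (ε / 2) (half_pos hε)
  refine ⟨m, hm, supNorm_lt_of_forall_lt hε fun x hx => ?_⟩
  rw [norm_sub_rev]
  exact hmx x hx

end DSFlow

theorem mainTheorem6 (d : ℕ) (hd : 2 ≤ d) (φ : ℝ → ℝ) (hφ : Continuous φ)
    (hφ_poly : ¬ ∃ p : Polynomial ℝ, ∀ x, φ x = p.eval x) :
    (∀ g ∈ DSFlow.DSF φ d, DSFlow.IsLocallyBounded g) ∧
      DSFlow.IsSupUniversal (DSFlow.INN (DSFlow.DSF φ d)) (DSFlow.SingleCoord d 1) ∧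
      DSFlow.IsSupUniversal (DSFlow.INN (DSFlow.DSF φ d)) (DSFlow.DTwo d) :=
  ⟨fun _ hg => DSFlow.isLocallyBounded_of_continuous (DSFlow.continuous_of_mem_DSF hφ hg),
    DSFlow.isSupUniversal_singleCoord hφ hφ_poly (by omega),
    DSFlow.isSupUniversal_DTwo hφ hφ_poly d⟩
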